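/- All graphs are finite and simple. For a perfect matching $M$ of a graph $G$, let $af(G,M)$ be the least cardinality of a set $S\subseteq E(G)\setminus M$ such that $M$ is the unique perfect matching of $G-S$, and let $Af(G)$ be the maximum of $af(G,M)$ over all perfect matchings $M$ of $G$. Let $r(G)=|E(G)|-|V(G)|+c(G)$ be the cyclomatic number of $G$, where $c(G)$ is the number of connected components of $G$. An edge of $G$ is fixed if it belongs to all perfect matchings of $G$ or to none of them. A normal component of $G$ is a connected component of the subgraph formed by the non-fixed edges of $G$ and their end vertices. A block of $G$ is a maximal connected subgraph without a cut vertex. A bipartite ear decomposition of a bipartite graph $H$ is a sequence of graphs $(G_0,G_1,\dots,G_r=H)$ in which $G_0$ consists of a single edge and its ends, and, for $1\le i\le r$, $G_i=G_{i-1}+P_i$ for a path $P_i$ of odd length (the $i$-th ear) that joins two vertices $u_i,v_i$ of $G_{i-1}$ of different colors and has no other vertices and no edges in common with $G_{i-1}$. **Theorem.** Let $G$ be a graph with a perfect matching. Then $Af(G)=r(G)$ if and only if $G$ is planar and bipartite and each block $B$ of $G$ is * either a single fixed edge of $G$ (with its two ends), * or a normal component of $G$ that has a perfect matching $M$ and a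 bipartite ear decomposition $(G_0,G_1,\dots,G_r=B)$ with $r=r(B)\ge 1$, such that $M_i=M\cap E(G_i)$ is a perfect matching of $G_i$ for $0\le i\le r$, and the ends of the $i$-th ear satisfy $u_iv_i\in M_{i-1}$ for $1\le i\le r$. -/

import Mathlib

namespace AntiForcing

/-! ### Perfect matchings and anti-forcing numbers -/

/-- `M` is a perfect matching of the subgraph `H`: a set of disjoint edges of `H` covering all
vertices of `H`. -/
def IsPerfectMatchingOf {V : Type*} {G : SimpleGraph V} (M H : G.Subgraph) : Prop :=
  M ≤ H ∧ M.IsMatching ∧ M.verts = H.verts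

/-- `S ⊆ E(G) \ M` is an anti-forcing set of `M` when `M` is the unique perfect matching
of `G - S`. -/
def IsAntiForcingSet {V : Type*} {G : SimpleGraph V} (M : G.Subgraph) (S : Set (Sym2 V)) : Prop :=
  S ⊆ G.edgeSet \ M.edgeSet ∧
    IsPerfectMatchingOf M ((⊤ : G.Subgraph).deleteEdges S) ∧
    ∀ M' : G.Subgraph, IsPerfectMatchingOf M' ((⊤ : G.Subgraph).deleteEdges S) → M' = M

/-- The anti-forcing number `af(G, M)`: the least cardinality of an anti-forcing set of `M`.
(For a perfect matching `M` of a finite graph, `E(G) \ M` is an anti-forcing set.) -/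
noncomputable def antiForcingNumber {V : Type*} {G : SimpleGraph V} (M : G.Subgraph) : ℕ :=
  sInf {n : ℕ | ∃ S : Finset (Sym2 V), IsAntiForcingSet M (S : Set (Sym2 V)) ∧ S.card = n}

/-- The maximum anti-forcing number `Af(G)`: the largest `af(G, M)` over all perfect matchings
`M` of the finite graph `G`. -/
noncomputable def maxAntiForcingNumber {V : Type*} (G : SimpleGraph V) : ℕ :=
  sSup {n : ℕ | ∃ M : G.Subgraph, M.IsPerfectMatching ∧ antiForcingNumber M = n}

/-- The cyclomatic number `r(G) = |E(G)| - |V(G)| + c(G)` of a finite graph, where `c(G)` is the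
number of connected components (so `|E(G)| - |V(G)| + 1` if `G` is connected). -/
noncomputable def cyclomaticNumber {V : Type*} (G : SimpleGraph V) : ℤ :=
  (Nat.card G.edgeSet : ℤ) - (Nat.card V : ℤ) + (Nat.card G.ConnectedComponent : ℤ)

/-! ### Planarity -/

/-- A drawing of `G` in the Euclidean plane without crossings: vertices are distinct points, each
edge is a simple arc joining its two ends and containing no other vertex, and two distinct edges
meet only in common end vertices. -/
structure PlaneDrawing {V : Type*} (G : SimpleGraph V) where
  /-- the point representing a vertex -/
  point : V → EuclideanSpace ℝ (Fin 2)
  /-- the point set representing an edge -/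
  arc : Sym2 V → Set (EuclideanSpace ℝ (Fin 2))
  point_injective : Function.Injective point
  isArc : ∀ u v : V, G.Adj u v →
    ∃ γ : Path (point u) (point v), Function.Injective γ ∧ Set.range γ = arc s(u, v)
  vertex_mem_arc : ∀ e ∈ G.edgeSet, ∀ w : V, point w ∈ arc e → w ∈ e
  arc_inter_arc : ∀ e ∈ G.edgeSet, ∀ f ∈ G.edgeSet, e ≠ f →
    arc e ∩ arc f ⊆ point '' {w : V | w ∈ e ∧ w ∈ f}

/-- A graph is planar if it can be drawn in the plane without crossings. -/
def IsPlanar {V : Type*} (G : SimpleGraph V) : Prop :=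
  Nonempty (PlaneDrawing G)

/-! ### Blocks -/

/-- A connected subgraph without a cut vertex: deleting any one of its vertices does not
disconnect it. -/
def IsNonseparable {V : Type*} {G : SimpleGraph V} (H : G.Subgraph) : Prop :=
  H.Connected ∧ ∀ v ∈ H.verts, (H.deleteVerts {v}).Preconnected

/-- A block of `G`: a maximal connected subgraph without a cut vertex. -/
def IsBlock {V : Type*} {G : SimpleGraph V} (B : G.Subgraph) : Prop :=
  Maximal IsNonseparable B

/-! ### Fixed edges and normal components -/

/-- A fixed single edge: an edge of `G` in no perfect matching. -/
def IsFixedSingle {V : Type*} (G : SimpleGraph V) (e : Sym2 V) : Prop :=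
  e ∈ G.edgeSet ∧ ∀ M : G.Subgraph, M.IsPerfectMatching → e ∉ M.edgeSet

/-- A fixed double edge: an edge of `G` in all perfect matchings. -/
def IsFixedDouble {V : Type*} (G : SimpleGraph V) (e : Sym2 V) : Prop :=
  e ∈ G.edgeSet ∧ ∀ M : G.Subgraph, M.IsPerfectMatching → e ∈ M.edgeSet

/-- A fixed edge of `G`. -/
def IsFixedEdge {V : Type*} (G : SimpleGraph V) (e : Sym2 V) : Prop :=
  IsFixedSingle G e ∨ IsFixedDouble G e

/-- The subgraph formed by the non-fixed edges of `G` and their end vertices. -/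
def nonFixedSubgraph {V : Type*} (G : SimpleGraph V) : G.Subgraph where
  verts := {u : V | ∃ v : V, G.Adj u v ∧ ¬ IsFixedEdge G s(u, v)}
  Adj u v := G.Adj u v ∧ ¬ IsFixedEdge G s(u, v)
  adj_sub h := h.1
  edge_vert h := ⟨_, h⟩
  symm := ⟨fun u v h => ⟨h.1.symm, by rw [Sym2.eq_swap]; exact h.2⟩⟩

/-- A normal (elementary) component of `G`: a connected component, i.e. a maximal connected
subgraph, of the subgraph formed by the non-fixed edges. -/
def IsNormalComponent {V : Type*} {G : SimpleGraph V} (H : G.Subgraph) : Prop :=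
  Maximal (fun K : G.Subgraph => K ≤ nonFixedSubgraph G ∧ K.Connected) H

/-! ### Ear decompositions -/

/-- `P` is an ear that can be added to the subgraph `K` of a bipartite graph: a path of odd length
joining two vertices of `K` of different colors, having no other vertices (and no edges) in common
with `K`. -/
structure IsEar {V : Type*} {G : SimpleGraph V} (K : G.Subgraph) {u v : V} (P : G.Walk u v) :
    Prop where
  isPath : P.IsPath
  odd_length : Odd P.length
  left_mem : u ∈ K.verts
  right_mem : v ∈ K.verts
  color_ne : ∀ c : G.Coloring Bool, c u ≠ c v
  inner_disjoint : ∀ w ∈ P.support, w ∈ K.verts → w = u ∨ w = v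
  edge_disjoint : ∀ e ∈ P.edges, e ∉ K.edgeSet

/-- A bipartite ear decomposition `(G_0, G_1, …, G_r = H)` of the subgraph `H` of a bipartite graph
`G`: `G_0` is a single edge, and each further graph arises from the preceding one by adding an
ear. (The `i`-th ear, `1 ≤ i ≤ r`, has index `i - 1` in `Fin r`.) -/
structure BipartiteEarDecomposition {V : Type*} {G : SimpleGraph V} (H : G.Subgraph) where
  r : ℕ
  graph : Fin (r + 1) → G.Subgraph
  u : Fin r → V
  v : Fin r → V
  ear : (i : Fin r) → G.Walk (u i) (v i)
  graph_zero : ∃ (a b : V) (h : G.Adj a b), graph 0 = G.subgraphOfAdj h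
  isEar : ∀ i : Fin r, IsEar (graph i.castSucc) (ear i)
  graph_succ : ∀ i : Fin r, graph i.succ = graph i.castSucc ⊔ (ear i).toSubgraph
  graph_last : graph (Fin.last r) = H

/-- `H` has a perfect matching `M` and a bipartite ear decomposition `(G_0, …, G_r = H)`, with
`r = r(H) ≥ 1`, such that every `M_i = M ∩ E(G_i)` is a perfect matching of `G_i` and the two ends
of the `i`-th ear are joined by an edge of `M_{i-1}`. -/
def HasSpecialEarDecomposition {V : Type*} {G : SimpleGraph V} (H : G.Subgraph) : Prop :=
  ∃ (M : G.Subgraph) (D : BipartiteEarDecomposition H),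
    IsPerfectMatchingOf M H ∧
    (D.r : ℤ) = cyclomaticNumber H.coe ∧
    1 ≤ D.r ∧
    (∀ i : Fin (D.r + 1), IsPerfectMatchingOf (M ⊓ D.graph i) (D.graph i)) ∧
    ∀ i : Fin D.r, (M ⊓ D.graph i.castSucc).Adj (D.u i) (D.v i)

end AntiForcing

/-! ### Perfect matchings as involutions, and rigid matchings -/

open SimpleGraph Relation

namespace AntiForcing

variable {V : Type*}

/-! The complements of the anti-forcing sets of `M` are the spanning subgraphs `H` of `G` in which
`M` is the unique perfect matching. A forest has at most one perfect matching, so a spanning forest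
through `M` is such an `H`, and `af(G, M) ≤ r(G)`. Any such `H` can be enlarged by bridges until it
has the components of `G`; hence equality holds exactly when no such `H` contains a cycle. This is
`Rigid`, and `maxAntiForcingNumber_eq_iff` reduces the theorem to the existence of a rigid matching.

Let `μ` be rigid. If an edge closes a cycle with a forest through `μ`, there must be a second
perfect matching, and it uses that edge. Counting colors shows that `G` is bipartite
(`Rigid.isBipartite`), and the fixed edges turn out to be the bridges (`Rigid.isFixedEdge_iff`).
Normal components have no cut vertex by parity, so the blocks are the fixed edges and the normal
components (`Rigid.isBlock_cases`).

Ears come from a potential argument. Let `K` be closed under `μ` and alternatingly connected inside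
each normal component (`Good`). Leave `K` at `x` by a non-fixed edge and return by a shortest
alternating walk, at `z` say. If `z ≠ μ x`, a potential that grows along the non-matching edges
singles out a subgraph in which `μ` is unique but which has a cycle through the first edge, against
rigidity (`Rigid.exit_eq`). So `z = μ x`, the walk is an ear over a matching edge, and `K` together
with it is `Good` again. Ears exhaust each normal component (`Rigid.hasSpecialEarDecomposition`). An
ear over an edge can be drawn close to that edge and a bridge can be drawn as a pendant edge, which
gives planarity (`Rigid.drawable`).

Conversely, the matchings of the decomposed blocks glue to one matching `μ`. Let `μ` be unique in
`H` and let `C` be a cycle of `H`; it lies in one block. `H` misses an edge of the last ear, since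
otherwise `μ` could be exchanged along that ear; inner vertices of the ear have degree two, so `C`
avoids the whole ear. Descending through the decomposition confines `C` to a single edge, which is
absurd (`exists_rigid`). -/

/-- A perfect matching of `G`, given as the involution exchanging matched vertices. -/
structure IsPM (G : SimpleGraph V) (μ : V → V) : Prop where
  adj : ∀ v, G.Adj v (μ v)
  invol : ∀ v, μ (μ v) = v

namespace IsPM

variable {G H : SimpleGraph V} {μ : V → V}

lemma ne (h : IsPM G μ) (v : V) : μ v ≠ v := (h.adj v).ne'

lemma inj (h : IsPM G μ) {a b : V} (hab : μ a = μ b) : a = b := by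
  rw [← h.invol a, hab, h.invol]

lemma eq_comm (h : IsPM G μ) {a b : V} : μ a = b ↔ a = μ b :=
  ⟨fun e => by rw [← e, h.invol], fun e => by rw [e, h.invol]⟩

lemma mono (h : IsPM H μ) (hle : H ≤ G) : IsPM G μ := ⟨fun v => hle (h.adj v), h.invol⟩

/-- The perfect matching as a subgraph. -/
def toSubgraph (h : IsPM G μ) : G.Subgraph where
  verts := Set.univ
  Adj a b := b = μ a
  adj_sub := by rintro a b rfl; exact h.adj a
  edge_vert _ := trivial
  symm := ⟨by rintro a b rfl; exact (h.invol a).symm⟩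

lemma isPerfectMatching_toSubgraph (h : IsPM G μ) : h.toSubgraph.IsPerfectMatching :=
  Subgraph.isPerfectMatching_iff.2 fun v => ⟨μ v, rfl, fun _ hw => hw⟩

/-- The graph whose edges are the matching edges. -/
def graph (h : IsPM G μ) : SimpleGraph V where
  Adj a b := b = μ a
  symm := ⟨by rintro a b rfl; exact (h.invol a).symm⟩
  loopless := ⟨fun a ha => h.ne a (Eq.symm ha)⟩

lemma graph_le_iff (h : IsPM G μ) : h.graph ≤ H ↔ IsPM H μ :=
  ⟨fun hle => ⟨fun v => hle (show μ v = μ v from rfl), h.invol⟩,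
    fun hH a b hab => by rw [show b = μ a from hab]; exact hH.adj a⟩

lemma isPM_graph (h : IsPM G μ) : IsPM h.graph μ := h.graph_le_iff.1 le_rfl

lemma isAcyclic_graph (h : IsPM G μ) : h.graph.IsAcyclic := by
  rw [isAcyclic_iff_forall_adj_isBridge]
  rintro a b hab
  rw [isBridge_iff]
  rintro ⟨p⟩
  cases p with
  | nil => exact hab.ne rfl
  | cons hadj _ =>
    rw [deleteEdges_adj] at hadj
    obtain ⟨h1, h2⟩ := hadj
    rw [show _ = μ a from h1, show b = μ a from hab] at h2
    exact h2 rfl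

end IsPM

lemma exists_isPM {G : SimpleGraph V} {M : G.Subgraph} (hM : M.IsPerfectMatching) :
    ∃ μ, IsPM G μ ∧ ∀ a b, M.Adj a b ↔ b = μ a := by
  choose μ h1 h2 using Subgraph.isPerfectMatching_iff.1 hM
  exact ⟨μ, ⟨fun v => (h1 v).adj_sub, fun v => (h2 _ _ (h1 v).symm).symm⟩,
    fun a b => ⟨fun h => h2 _ _ h, fun h => h ▸ h1 a⟩⟩

/-- `μ` is the only perfect matching of `H`. -/
def IsUniquePM (H : SimpleGraph V) (μ : V → V) : Prop :=
  IsPM H μ ∧ ∀ μ', IsPM H μ' → μ' = μ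

/-- Every subgraph of `G` in which `μ` is the unique perfect matching is a forest. -/
def Rigid (G : SimpleGraph V) (μ : V → V) : Prop :=
  IsPM G μ ∧ ∀ H ≤ G, IsUniquePM H μ → H.IsAcyclic

/-! ### Parity, bridges and uniqueness of perfect matchings -/

section Parity

lemma even_ncard_of_involution [Finite V] (X : Set V) (μ : V → V) (hX : ∀ q ∈ X, μ q ∈ X)
    (hne : ∀ q ∈ X, μ q ≠ q) (hinv : ∀ q ∈ X, μ (μ q) = q) : Even X.ncard := by
  classical
  have hf := X.toFinite
  rw [Set.ncard_eq_toFinset_card X hf]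
  have : ∑ q ∈ hf.toFinset, (1 : ZMod 2) = 0 := by
    refine Finset.sum_involution (fun q _ => μ q) ?_ ?_ ?_ ?_
    · intros; decide
    · intro q hq _; exact hne q (by simpa using hq)
    · intro q hq; simpa using hX q (by simpa using hq)
    · intro q hq; exact hinv q (by simpa using hq)
  rw [Finset.sum_const, nsmul_eq_mul, mul_one] at this
  exact (ZMod.natCast_eq_zero_iff_even).1 this

/-- A set closed under one perfect matching cannot be closed under another one up to a single
vertex. -/
lemma parity_obstruction [Finite V] {G G' : SimpleGraph V} {μ μ' : V → V} (h : IsPM G μ)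
    (h' : IsPM G' μ') (X : Set V) {x : V} (hx : x ∈ X) (hX : ∀ q ∈ X, μ q ∈ X)
    (hX' : ∀ q ∈ X, q ≠ x → μ' q ∈ X) (hx' : μ' x ∉ X) : False := by
  have e1 := even_ncard_of_involution X μ hX (fun q _ => h.ne q) (fun q _ => h.invol q)
  have e2 := even_ncard_of_involution (X \ {x}) μ'
    (fun q hq => ⟨hX' q hq.1 hq.2, fun e => hx' <| by
      rw [← h'.eq_comm.1 (show μ' q = x from e)]
      exact hq.1⟩)
    (fun q _ => h'.ne q) (fun q _ => h'.invol q)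
  have := Set.ncard_sdiff_singleton_add_one hx
  rw [← this] at e1
  grind

/-- If `μ` avoided the bridge, the side of `x` left after deleting it would be closed under `μ`,
while `μ'` would leave it only at `x`; this contradicts parity. -/
lemma IsPM.eq_of_isBridge [Finite V] {H : SimpleGraph V} {μ μ' : V → V} (h : IsPM H μ)
    (h' : IsPM H μ') {x : V} (hb : H.IsBridge s(x, μ' x)) : μ x = μ' x := by
  by_contra hne
  rw [isBridge_iff] at hb
  refine parity_obstruction h h' {q | (H.deleteEdges {s(x, μ' x)}).Reachable x q}
    (x := x) (Reachable.refl _) ?_ ?_ hb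
  · intro q hq
    refine Reachable.trans hq (Adj.reachable ?_)
    rw [deleteEdges_adj]
    refine ⟨h.adj q, fun e => ?_⟩
    rcases Sym2.eq_iff.1 e with ⟨rfl, e⟩ | ⟨rfl, e⟩
    · exact hne e
    · exact hne (h.eq_comm.1 e).symm
  · intro q hq hqx
    refine Reachable.trans hq (Adj.reachable ?_)
    rw [deleteEdges_adj]
    refine ⟨h'.adj q, fun e => ?_⟩
    rcases Sym2.eq_iff.1 e with ⟨rfl, e⟩ | ⟨rfl, e⟩
    · exact hqx rfl
    · exact hb hq

lemma IsPM.isUniquePM_of_isAcyclic [Finite V] {H : SimpleGraph V} {μ : V → V} (h : IsPM H μ)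
    (hH : H.IsAcyclic) : IsUniquePM H μ := by
  refine ⟨h, fun μ' h' => funext fun x => ?_⟩
  exact (h.eq_of_isBridge h' (isAcyclic_iff_forall_isBridge.1 hH (h'.adj x))).symm

/-- Adding a bridge preserves uniqueness of the perfect matching. -/
lemma IsUniquePM.sup_edge [Finite V] {H : SimpleGraph V} {μ : V → V} (h : IsUniquePM H μ)
    {x y : V} (hxy : ¬ H.Reachable x y) : IsUniquePM (H ⊔ edge x y) μ := by
  have hle : H ≤ H ⊔ edge x y := le_sup_left
  refine ⟨h.1.mono hle, fun μ' h' => h.2 μ' ⟨fun v => ?_, h'.invol⟩⟩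
  have hb : (H ⊔ edge x y).IsBridge s(x, y) :=
    isBridge_sup_edge.2 (IsBridge.of_not_reachable hxy)
  rcases (h'.adj v : _ ∨ _) with hv | hv
  · exact hv
  · rw [edge_adj] at hv
    have hs : s(v, μ' v) = s(x, y) := by
      rw [Sym2.eq_iff]; tauto
    rw [← (h.1.mono hle).eq_of_isBridge h' (hs ▸ hb)]
    exact h.1.adj v

end Parity

/-! ### Counting edges and components of forests -/

section Counting

lemma reachable_sup_edge {H : SimpleGraph V} {u v a b : V} (h : (H ⊔ edge u v).Reachable a b) :
    H.Reachable a b ∨ (H.Reachable a u ∧ H.Reachable v b) ∨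
      (H.Reachable a v ∧ H.Reachable u b) := by
  obtain ⟨p⟩ := h
  induction p with
  | nil => exact Or.inl (Reachable.refl _)
  | cons hadj p ih =>
    rcases (hadj : _ ∨ _) with hv | hv
    · have := hv.reachable
      rcases ih with ih | ⟨ih, ih'⟩ | ⟨ih, ih'⟩
      · exact Or.inl (this.trans ih)
      · exact Or.inr (Or.inl ⟨this.trans ih, ih'⟩)
      · exact Or.inr (Or.inr ⟨this.trans ih, ih'⟩)
    · rw [edge_adj] at hv
      obtain ⟨⟨rfl, rfl⟩ | ⟨rfl, rfl⟩, -⟩ := hv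
      · rcases ih with ih | ⟨ih, ih'⟩ | ⟨ih, ih'⟩
        · exact Or.inr (Or.inl ⟨Reachable.refl _, ih⟩)
        · exact Or.inr (Or.inl ⟨Reachable.refl _, ih'⟩)
        · exact Or.inl ih'
      · rcases ih with ih | ⟨ih, ih'⟩ | ⟨ih, ih'⟩
        · exact Or.inr (Or.inr ⟨Reachable.refl _, ih⟩)
        · exact Or.inl ih'
        · exact Or.inr (Or.inr ⟨Reachable.refl _, ih'⟩)

/-- The new edge merges two components: leaving out the one of `v`, the others map bijectively onto
the components of the larger graph. -/
lemma card_connectedComponent_sup_edge [Finite V] {H : SimpleGraph V} {u v : V}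
    (h : ¬ H.Reachable u v) :
    Nat.card (H ⊔ edge u v).ConnectedComponent + 1 = Nat.card H.ConnectedComponent := by
  classical
  set K := H ⊔ edge u v
  have hle : H ≤ K := le_sup_left
  have huv : K.Reachable u v :=
    Adj.reachable (Or.inr (by rw [edge_adj]; exact ⟨Or.inl ⟨rfl, rfl⟩, fun e => h (e ▸ .refl _)⟩))
  let f : {c : H.ConnectedComponent // c ≠ H.connectedComponentMk v} → K.ConnectedComponent :=
    fun c => c.1.map (Hom.ofLE hle)
  have hf : Function.Bijective f := by
    constructor
    · rintro ⟨c, hc⟩ ⟨d, hd⟩ hcd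
      induction c using ConnectedComponent.ind with | _ a
      induction d using ConnectedComponent.ind with | _ b
      have hab : K.Reachable a b := ConnectedComponent.exact hcd
      have ha : ¬ H.Reachable a v := fun e => hc (ConnectedComponent.sound e)
      have hb : ¬ H.Reachable b v := fun e => hd (ConnectedComponent.sound e)
      refine Subtype.ext (ConnectedComponent.sound ?_)
      rcases reachable_sup_edge hab with e | ⟨_, e⟩ | ⟨e, _⟩
      · exact e
      · exact absurd e.symm hb
      · exact absurd e ha
    · intro c
      induction c using ConnectedComponent.ind with | _ a
      by_cases ha : H.Reachable a v
      · exact ⟨⟨H.connectedComponentMk u, fun e => h (ConnectedComponent.exact e)⟩,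
          ConnectedComponent.sound (huv.trans (ha.mono hle).symm)⟩
      · exact ⟨⟨H.connectedComponentMk a, fun e => ha (ConnectedComponent.exact e)⟩, rfl⟩
  rw [← Nat.card_eq_of_bijective f hf]
  have : Nat.card {c : H.ConnectedComponent // c ≠ H.connectedComponentMk v} =
      ({H.connectedComponentMk v}ᶜ : Set H.ConnectedComponent).ncard := rfl
  rw [this, ← Set.ncard_add_ncard_compl ({H.connectedComponentMk v} : Set H.ConnectedComponent),
    Set.ncard_singleton, add_comm]

lemma card_edgeSet_add_card_connectedComponent [Finite V] {F : SimpleGraph V}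
    (hF : F.IsAcyclic) : F.edgeSet.ncard + Nat.card F.ConnectedComponent = Nat.card V := by
  induction hn : F.edgeSet.ncard generalizing F with
  | zero =>
    have : F = ⊥ := by
      rw [← edgeSet_eq_empty]; exact (Set.ncard_eq_zero).1 hn
    subst this
    rw [zero_add]
    refine (Nat.card_eq_of_bijective (fun v => (⊥ : SimpleGraph V).connectedComponentMk v)
      ⟨fun a b hab => ?_, fun c => ?_⟩).symm
    · exact reachable_bot.1 (ConnectedComponent.exact hab)
    · induction c using ConnectedComponent.ind with | _ a
      exact ⟨a, rfl⟩
  | succ n ih =>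
    obtain ⟨e, he⟩ := (Set.ncard_pos (s := F.edgeSet)).1 (by omega)
    induction e with | h u v
    have hb := isAcyclic_iff_forall_isBridge.1 hF he
    rw [isBridge_iff] at hb
    have h1 := ih (F := F.deleteEdges {s(u, v)}) (hF.anti (deleteEdges_le _)) (by
      rw [edgeSet_deleteEdges, Set.ncard_sdiff_singleton_of_mem he, hn]; rfl)
    have h2 := card_connectedComponent_sup_edge hb
    have h3 : F.deleteEdges {s(u, v)} ⊔ edge u v = F := by
      ext a b
      simp only [sup_adj, deleteEdges_adj, edge_adj, Set.mem_singleton_iff, Sym2.eq_iff]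
      have := (mem_edgeSet F).1 he
      constructor
      · rintro (h | ⟨⟨rfl, rfl⟩ | ⟨rfl, rfl⟩, _⟩)
        · exact h.1
        · exact this
        · exact this.symm
      · intro h
        have := h.ne
        tauto
    rw [h3] at h2
    omega

lemma card_connectedComponent_congr {F G : SimpleGraph V} (h : F.Reachable = G.Reachable) :
    Nat.card F.ConnectedComponent = Nat.card G.ConnectedComponent := by
  unfold ConnectedComponent
  rw [h]

lemma cyclomaticNumber_eq (G : SimpleGraph V) :
    cyclomaticNumber G = (G.edgeSet.ncard : ℤ) - Nat.card V + Nat.card G.ConnectedComponent := rfl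

lemma card_spanning_forest [Finite V] {F G : SimpleGraph V} (hF : F.IsAcyclic)
    (h : F.Reachable = G.Reachable) :
    (F.edgeSet.ncard : ℤ) = G.edgeSet.ncard - cyclomaticNumber G := by
  have := card_edgeSet_add_card_connectedComponent hF
  rw [card_connectedComponent_congr h] at this
  rw [cyclomaticNumber_eq]
  omega

end Counting

/-! ### Reduction to rigid matchings -/

section MaxAntiForcing

variable [Finite V] {G : SimpleGraph V}

omit [Finite V] in
lemma isAntiForcingSet_iff {M : G.Subgraph} {μ : V → V} (hμ : IsPM G μ)
    (hM : ∀ a b, M.Adj a b ↔ b = μ a) (hsp : M.verts = Set.univ) (S : Set (Sym2 V)) :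
    IsAntiForcingSet M S ↔ S ⊆ G.edgeSet \ M.edgeSet ∧ IsUniquePM (G.deleteEdges S) μ := by
  constructor
  · rintro ⟨h1, h2, h3⟩
    refine ⟨h1, ⟨fun v => ?_, hμ.invol⟩, fun μ' h' => ?_⟩
    · rw [deleteEdges_adj]
      exact ⟨hμ.adj v, fun e => (h1 e).2 ((hM _ _).2 rfl)⟩
    · have hG' := h'.mono (deleteEdges_le S)
      have := h3 hG'.toSubgraph ⟨⟨fun _ _ => trivial, fun a b hab => ?_⟩,
        hG'.isPerfectMatching_toSubgraph.1, rfl⟩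
      · funext v
        exact (hM _ _).1 (this ▸ (rfl : hG'.toSubgraph.Adj v (μ' v)))
      · obtain rfl : b = μ' a := hab
        simpa [Subgraph.deleteEdges_adj] using h'.adj a
  · rintro ⟨h1, h2, h3⟩
    refine ⟨h1, ⟨⟨fun _ _ => trivial, fun a b hab => ?_⟩, ?_, hsp⟩, ?_⟩
    · obtain rfl : b = μ a := (hM _ _).1 hab
      simpa [Subgraph.deleteEdges_adj] using h2.adj a
    · intro v _
      exact ⟨μ v, (hM _ _).2 rfl, fun w hw => (hM _ _).1 hw⟩
    · rintro M' ⟨hle, hm, hv⟩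
      have hsp' : M'.verts = Set.univ := hv
      obtain ⟨μ', hμ', hM'⟩ := exists_isPM (M := M') ⟨hm, fun v => hsp' ▸ trivial⟩
      have : μ' = μ := h3 μ' ⟨fun v => by
        have := hle.2 ((hM' v _).2 rfl)
        simpa [Subgraph.deleteEdges_adj] using this, hμ'.invol⟩
      subst this
      ext a b
      · rw [hsp, hsp']
      · rw [hM, hM']

lemma antiForcingNumber_le {M : G.Subgraph} {S : Set (Sym2 V)} (hS : IsAntiForcingSet M S) :
    antiForcingNumber M ≤ S.ncard := by
  refine Nat.sInf_le ⟨S.toFinite.toFinset, by simpa using hS, ?_⟩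
  rw [Set.ncard_eq_toFinset_card S]

/-- In a maximal `K` no edge of `G` can join two components of `K`, because by `IsUniquePM.sup_edge`
it could still be added. -/
lemma exists_isUniquePM_maximal {μ : V → V} {H : SimpleGraph V} (hle : H ≤ G)
    (h : IsUniquePM H μ) : ∃ K ≤ G, H ≤ K ∧ IsUniquePM K μ ∧ K.Reachable = G.Reachable := by
  obtain ⟨K, hHK, hK⟩ := (Set.toFinite {K : SimpleGraph V | K ≤ G ∧ IsUniquePM K μ}).exists_le_maximal
    (show H ∈ _ from ⟨hle, h⟩)
  refine ⟨K, hK.1.1, hHK, hK.1.2, ?_⟩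
  have key : ∀ x y, G.Adj x y → K.Reachable x y := by
    intro x y hxy
    by_contra hn
    have hle' : K ⊔ edge x y ≤ G := sup_le hK.1.1 (by
      intro a b hab
      rw [edge_adj] at hab
      obtain ⟨⟨rfl, rfl⟩ | ⟨rfl, rfl⟩, _⟩ := hab
      · exact hxy
      · exact hxy.symm)
    have := hK.2 (show K ⊔ edge x y ∈ _ from ⟨hle', hK.1.2.sup_edge hn⟩) le_sup_left
    exact hn (Adj.reachable (this (Or.inr (by rw [edge_adj]; exact ⟨Or.inl ⟨rfl, rfl⟩, hxy.ne⟩))))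
  ext x y
  refine ⟨fun h => h.mono hK.1.1, fun ⟨p⟩ => ?_⟩
  induction p with
  | nil => exact Reachable.refl _
  | cons hadj p ih => exact (key _ _ hadj).trans (ih ⟨p⟩)

omit [Finite V] in
lemma isAntiForcingSet_sdiff {M : G.Subgraph} {μ : V → V} (hμ : IsPM G μ)
    (hM : ∀ a b, M.Adj a b ↔ b = μ a) (hsp : M.verts = Set.univ) {K : SimpleGraph V} (hK : K ≤ G)
    (h : IsUniquePM K μ) : IsAntiForcingSet M (G.edgeSet \ K.edgeSet) := by
  rw [isAntiForcingSet_iff hμ hM hsp]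
  refine ⟨fun e he => ⟨he.1, fun he' => he.2 ?_⟩, ?_⟩
  · induction e with | h a b
    obtain rfl := (hM a b).1 he'
    exact h.1.adj a
  · convert h
    ext a b
    rw [deleteEdges_adj]
    have : K.Adj a b → G.Adj a b := fun e => hK e
    simp
    tauto

lemma ncard_edgeSet_sdiff {K : SimpleGraph V} (hK : K ≤ G) :
    ((G.edgeSet \ K.edgeSet).ncard : ℤ) = G.edgeSet.ncard - K.edgeSet.ncard := by
  have := Set.ncard_sdiff_add_ncard_of_subset (edgeSet_mono hK)
  omega

/-- The edges outside a spanning forest through the matching form an anti-forcing set of size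
`r(G)`. -/
lemma antiForcingNumber_le_cyclomaticNumber {M : G.Subgraph} (hM : M.IsPerfectMatching) :
    (antiForcingNumber M : ℤ) ≤ cyclomaticNumber G := by
  obtain ⟨μ, hμ, h⟩ := exists_isPM hM
  obtain ⟨F, h1, h2, h3, h4⟩ := exists_isAcyclic_reachable_eq_le_of_le_of_isAcyclic
    (hμ.graph_le_iff.2 hμ) hμ.isAcyclic_graph
  have := antiForcingNumber_le (isAntiForcingSet_sdiff hμ h
    (Set.eq_univ_of_forall hM.2) h2 ((hμ.graph_le_iff.1 h1).isUniquePM_of_isAcyclic h3))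
  have h5 := ncard_edgeSet_sdiff h2
  have h6 := card_spanning_forest h3 h4
  omega

/-- If `μ` is rigid and `S` is an optimal anti-forcing set, then `G - S` is a forest with at least
as many components as `G`, so `S` has at least `r(G)` edges. If instead some uniquely matched `H`
has a cycle, enlarge it to `K` with the components of `G`; `K` has more edges than a spanning
forest, and its complement is an anti-forcing set with fewer than `r(G)` edges. -/
lemma rigid_iff_antiForcingNumber {M : G.Subgraph} (hMp : M.IsPerfectMatching) {μ : V → V}
    (hμ : IsPM G μ) (hM : ∀ a b, M.Adj a b ↔ b = μ a) :
    Rigid G μ ↔ (antiForcingNumber M : ℤ) = cyclomaticNumber G := by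
  have hsp : M.verts = Set.univ := Set.eq_univ_of_forall hMp.2
  constructor
  · intro hr
    refine le_antisymm (antiForcingNumber_le_cyclomaticNumber hMp) ?_
    have hne : {n : ℕ | ∃ S : Finset (Sym2 V), IsAntiForcingSet M (S : Set (Sym2 V)) ∧
        S.card = n}.Nonempty := by
      have := isAntiForcingSet_sdiff hμ hM hsp (hμ.graph_le_iff.2 hμ)
        (hμ.isPM_graph.isUniquePM_of_isAcyclic hμ.isAcyclic_graph)
      exact ⟨_, (Set.toFinite _).toFinset, by simpa using this, rfl⟩
    obtain ⟨S, hS, hc⟩ := Nat.sInf_mem hne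
    rw [isAntiForcingSet_iff hμ hM hsp] at hS
    have h1 := card_edgeSet_add_card_connectedComponent (hr.2 _ (deleteEdges_le _) hS.2)
    have h2 := ConnectedComponent.card_le_card_of_le (deleteEdges_le (G := G) (S : Set (Sym2 V)))
    have h3 := Set.ncard_sdiff_add_ncard_of_subset (hS.1.trans Set.sdiff_subset)
    rw [Set.ncard_coe_finset] at h3
    rw [edgeSet_deleteEdges] at h1
    have h4 : antiForcingNumber M = S.card := hc.symm
    rw [cyclomaticNumber_eq, h4]
    omega
  · intro heq
    refine ⟨hμ, fun H hH hu => ?_⟩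
    by_contra hcyc
    obtain ⟨K, hKG, hHK, hKu, hKr⟩ := exists_isUniquePM_maximal hH hu
    obtain ⟨F, hFK, hF, hFr⟩ := K.exists_isAcyclic_reachable_eq_le
    have hlt : F < K := lt_of_le_of_ne hFK (by rintro rfl; exact hcyc (hF.anti hHK))
    have h1 := Set.ncard_lt_ncard (edgeSet_strict_mono hlt)
    have h2 := card_spanning_forest hF (hFr.trans hKr)
    have h3 := antiForcingNumber_le (isAntiForcingSet_sdiff hμ hM hsp hKG hKu)
    have h4 := ncard_edgeSet_sdiff hKG
    omega

theorem maxAntiForcingNumber_eq_iff (hG : ∃ M : G.Subgraph, M.IsPerfectMatching) :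
    (maxAntiForcingNumber G : ℤ) = cyclomaticNumber G ↔ ∃ μ, Rigid G μ := by
  set A : Set ℕ := {n : ℕ | ∃ M : G.Subgraph, M.IsPerfectMatching ∧ antiForcingNumber M = n}
  have hA : maxAntiForcingNumber G = sSup A := rfl
  have hne : A.Nonempty := hG.elim fun M hM => ⟨_, M, hM, rfl⟩
  have hle : ∀ n ∈ A, (n : ℤ) ≤ cyclomaticNumber G := by
    rintro n ⟨M, hM, rfl⟩
    exact antiForcingNumber_le_cyclomaticNumber hM
  -- On `ℕ`, `sSup` takes the default value `0` for unbounded sets; the bound makes it an attained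
  -- maximum.
  have hbdd : BddAbove A := ⟨(cyclomaticNumber G).toNat, fun n hn => by have := hle n hn; omega⟩
  have hmem := Nat.sSup_mem hne hbdd
  rw [hA]
  constructor
  · intro h
    obtain ⟨M, hM, hn⟩ := hmem
    obtain ⟨μ, hμ, hMμ⟩ := exists_isPM hM
    exact ⟨μ, (rigid_iff_antiForcingNumber hM hμ hMμ).2 (by rw [hn, h])⟩
  · rintro ⟨μ, hr⟩
    have h1 := (rigid_iff_antiForcingNumber hr.1.isPerfectMatching_toSubgraph hr.1
      (fun _ _ => Iff.rfl)).1 hr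
    refine le_antisymm (hle _ hmem) ?_
    rw [← h1]
    exact_mod_cast le_csSup hbdd ⟨_, hr.1.isPerfectMatching_toSubgraph, rfl⟩

end MaxAntiForcing

end AntiForcing

namespace AntiForcing

variable {V : Type*}

/-! ### Fixed edges of rigid graphs are bridges -/

section FixedEdges

variable {G : SimpleGraph V} {μ : V → V}

lemma not_isFixedEdge_iff {a b : V} (hab : G.Adj a b) :
    ¬ IsFixedEdge G s(a, b) ↔
      (∃ μ, IsPM G μ ∧ μ a = b) ∧ ∃ μ, IsPM G μ ∧ μ a ≠ b := by
  have hab' : s(a, b) ∈ G.edgeSet := hab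
  unfold IsFixedEdge IsFixedSingle IsFixedDouble
  rw [not_or, not_and, not_and]
  refine and_congr ⟨fun h => ?_, fun ⟨μ, hμ, e⟩ _ h => ?_⟩
    ⟨fun h => ?_, fun ⟨μ, hμ, e⟩ _ h => ?_⟩
  · have := h hab'
    push Not at this
    obtain ⟨M, hM, hm⟩ := this
    obtain ⟨μ, hμ, hMμ⟩ := exists_isPM hM
    exact ⟨μ, hμ, ((hMμ a b).1 hm).symm⟩
  · exact h _ hμ.isPerfectMatching_toSubgraph e.symm
  · have := h hab'
    push Not at this
    obtain ⟨M, hM, hm⟩ := this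
    obtain ⟨μ, hμ, hMμ⟩ := exists_isPM hM
    exact ⟨μ, hμ, fun e => hm ((hMμ a b).2 e.symm)⟩
  · exact e (show b = μ a from h _ hμ.isPerfectMatching_toSubgraph).symm

/-- Every perfect matching restricts to the non-fixed subgraph. -/
lemma nonFixedSubgraph_adj_of_mem (h : IsPM G μ) {v : V} (hv : v ∈ (nonFixedSubgraph G).verts) :
    (nonFixedSubgraph G).Adj v (μ v) := by
  obtain ⟨w, hvw, hf⟩ := hv
  refine ⟨h.adj v, (not_isFixedEdge_iff (h.adj v)).2 ⟨⟨μ, h, rfl⟩, ?_⟩⟩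
  obtain ⟨⟨μ₁, h₁, e₁⟩, μ₂, h₂, e₂⟩ := (not_isFixedEdge_iff hvw).1 hf
  by_cases hw : μ v = w
  · exact ⟨μ₂, h₂, by rwa [hw]⟩
  · exact ⟨μ₁, h₁, fun e => hw (by rw [← e, e₁])⟩

variable [Finite V]

/-- The graph `F + xy` has a cycle, so by rigidity it has a perfect matching other than `μ`; that
one must use `xy`, since `F` alone admits only `μ`. -/
lemma Rigid.exists_isPM_sup_edge (hr : Rigid G μ) {F : SimpleGraph V} (hFG : F ≤ G)
    (hF : F.IsAcyclic) (hμ : IsPM F μ) {x y : V} (hxy : G.Adj x y) (hre : F.Reachable x y)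
    (hn : ¬ F.Adj x y) : ∃ μ', IsPM (F ⊔ edge x y) μ' ∧ μ' x = y := by
  have hle : F ⊔ edge x y ≤ G := sup_le hFG (by
    intro a b hab
    rw [edge_adj] at hab
    obtain ⟨⟨rfl, rfl⟩ | ⟨rfl, rfl⟩, _⟩ := hab
    · exact hxy
    · exact hxy.symm)
  have hnu : ¬ IsUniquePM (F ⊔ edge x y) μ := fun hu => by
    rcases (isAcyclic_sup_fromEdgeSet_iff.1 (hr.2 _ hle hu)).2 hre with h | h
    · exact hxy.ne h
    · exact hn h
  unfold IsUniquePM at hnu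
  push Not at hnu
  obtain ⟨μ', h', hne⟩ := hnu (hμ.mono le_sup_left)
  refine ⟨μ', h', ?_⟩
  by_contra hx
  refine hne ((hμ.isUniquePM_of_isAcyclic hF).2 μ' ⟨fun v => ?_, h'.invol⟩)
  rcases (h'.adj v : _ ∨ _) with hv | hv
  · exact hv
  · rw [edge_adj] at hv
    obtain ⟨⟨rfl, e⟩ | ⟨rfl, e⟩, -⟩ := hv
    · exact absurd e hx
    · exact absurd (h'.eq_comm.1 e).symm hx

lemma Rigid.exists_isPM_of_not_isBridge (hr : Rigid G μ) {x y : V} (hxy : G.Adj x y)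
    (hne : μ x ≠ y) (hb : ¬ G.IsBridge s(x, y)) : ∃ μ', IsPM G μ' ∧ μ' x = y := by
  rw [isBridge_iff, not_not] at hb
  set G' := G.deleteEdges {s(x, y)} with hG'
  have hμ : IsPM G' μ := ⟨fun v => by
    rw [hG', deleteEdges_adj]
    refine ⟨hr.1.adj v, fun e => ?_⟩
    rcases Sym2.eq_iff.1 e with ⟨rfl, e'⟩ | ⟨rfl, e'⟩
    · exact hne e'
    · exact hne (hr.1.eq_comm.1 e').symm, hr.1.invol⟩
  obtain ⟨F, h1, h2, h3, h4⟩ := exists_isAcyclic_reachable_eq_le_of_le_of_isAcyclic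
    (hμ.graph_le_iff.2 hμ) hμ.isAcyclic_graph
  obtain ⟨μ', h', e⟩ := hr.exists_isPM_sup_edge (h2.trans (deleteEdges_le _)) h3
    (hμ.graph_le_iff.1 h1) hxy (by rw [h4]; exact hb) (fun h => by
      have := h2 h
      rw [hG', deleteEdges_adj] at this
      exact this.2 rfl)
  refine ⟨μ', h'.mono (sup_le (h2.trans (deleteEdges_le _)) ?_), e⟩
  intro a b hab
  rw [edge_adj] at hab
  obtain ⟨⟨rfl, rfl⟩ | ⟨rfl, rfl⟩, _⟩ := hab
  · exact hxy
  · exact hxy.symm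

/-- In a rigid graph the fixed edges are the bridges. -/
lemma Rigid.isFixedEdge_iff (hr : Rigid G μ) {a b : V} (hab : G.Adj a b) :
    IsFixedEdge G s(a, b) ↔ G.IsBridge s(a, b) := by
  rw [← not_iff_not, not_isFixedEdge_iff hab]
  constructor
  · rintro ⟨⟨μ₁, h₁, rfl⟩, μ₂, h₂, e⟩ hb
    exact e (h₂.eq_of_isBridge h₁ hb)
  · intro hb
    by_cases hm : μ a = b
    · refine ⟨⟨μ, hr.1, hm⟩, ?_⟩
      -- A matching edge that is not a bridge lies on a cycle. The other cycle edge at `a` is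
      -- neither a bridge nor in `μ`, so some perfect matching uses it and therefore avoids `ab`.
      obtain ⟨u, p, hp, he⟩ :=
        adj_and_reachable_delete_edges_iff_exists_cycle.1 ⟨hab, by rwa [isBridge_iff, not_not] at hb⟩
      have hadj : p.toSubgraph.Adj a b := by rwa [Walk.adj_toSubgraph_iff_mem_edges]
      have h2 := hp.ncard_neighborSet_toSubgraph_eq_two
        (Walk.mem_support_of_adj_toSubgraph hadj)
      obtain ⟨z, hz, hzb⟩ := Set.exists_ne_of_one_lt_ncard (by rw [h2]; norm_num) b
      have hz' : p.toSubgraph.Adj a z := hz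
      obtain ⟨μ', h', e'⟩ := hr.exists_isPM_of_not_isBridge hz'.adj_sub
        (by rw [hm]; exact hzb.symm) (fun hbr => hbr.notMem_edges_of_isCycle hp
          (Walk.adj_toSubgraph_iff_mem_edges.1 hz'))
      exact ⟨μ', h', by rw [e']; exact hzb⟩
    · exact ⟨hr.exists_isPM_of_not_isBridge hab hm hb, μ, hr.1, hm⟩

lemma Rigid.nonFixedSubgraph_adj (hr : Rigid G μ) {a b : V} :
    (nonFixedSubgraph G).Adj a b ↔ G.Adj a b ∧ ¬ G.IsBridge s(a, b) :=
  ⟨fun h => ⟨h.1, fun hb => h.2 ((hr.isFixedEdge_iff h.1).2 hb)⟩,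
    fun h => ⟨h.1, fun hb => h.2 ((hr.isFixedEdge_iff h.1).1 hb)⟩⟩

end FixedEdges

/-! ### Bipartiteness, and uniqueness from a potential -/

section Bipartite

variable [Finite V] {G : SimpleGraph V} {μ : V → V}

/-- Two-color a spanning forest through `μ` and give the colors signs `1` and `-1`; the pairs of `μ`
make the total zero. If `xy` joined equal colors, the matching `μ'` through `xy` would pair opposite
signs everywhere except at `xy`, making the total nonzero. -/
lemma Rigid.isBipartite (hr : Rigid G μ) : G.IsBipartite := by
  obtain ⟨F, h1, h2, h3, h4⟩ := exists_isAcyclic_reachable_eq_le_of_le_of_isAcyclic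
    (hr.1.graph_le_iff.2 hr.1) hr.1.isAcyclic_graph
  have hμ := hr.1.graph_le_iff.1 h1
  obtain ⟨c⟩ := h3.isBipartite
  refine ⟨Coloring.mk c fun {x y} hxy hc => ?_⟩
  have hn : ¬ F.Adj x y := fun h => c.valid h hc
  obtain ⟨μ', h', e⟩ := hr.exists_isPM_sup_edge h2 h3 hμ hxy (by rw [h4]; exact hxy.reachable) hn
  classical
  have := Fintype.ofFinite V
  let s : V → ℤ := fun v => if c v = 0 then 1 else -1
  have hs : ∀ a b, F.Adj a b → s b = - s a := by
    intro a b hab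
    have := c.valid hab
    simp only [s]
    split_ifs <;> omega
  have hsum0 : ∑ v, s v = 0 := by
    have h5 : ∑ v, s (μ v) = ∑ v, s v :=
      Fintype.sum_bijective μ (Function.Involutive.bijective hμ.invol) _ _ (fun _ => rfl)
    simp_rw [fun v => hs _ _ (hμ.adj v), Finset.sum_neg_distrib] at h5
    omega
  have hsum1 : ∑ v, (s v + s (μ' v)) = 0 := by
    rw [Finset.sum_add_distrib, hsum0, Fintype.sum_bijective μ'
      (Function.Involutive.bijective h'.invol) (fun v => s (μ' v)) s (fun _ => rfl), hsum0, add_zero]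
  have e' : μ' y = x := by rw [← e, h'.invol]
  have hsxy : s x = s y := by simp only [s, show c x = c y from hc]
  rw [← Finset.sum_subset (Finset.subset_univ {x, y}), Finset.sum_pair hxy.ne, e, e', hsxy] at hsum1
  · simp only [s] at hsum1
    split_ifs at hsum1 <;> omega
  · intro v _ hv
    simp only [Finset.mem_insert, Finset.mem_singleton, not_or] at hv
    have hadj : F.Adj v (μ' v) := by
      rcases (h'.adj v : _ ∨ _) with h | h
      · exact h
      · rw [edge_adj] at h
        tauto
    rw [hs _ _ hadj, add_neg_cancel]

omit [Finite V] in
lemma exists_boolColoring (h : G.IsBipartite) : Nonempty (G.Coloring Bool) := by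
  obtain ⟨c⟩ := h
  exact ⟨Coloring.mk (fun v => decide (c v = 0)) fun {x y} hxy hc => by
    have := c.valid hxy
    have h2 : (c x = 0) ↔ (c y = 0) := by simpa using hc
    omega⟩

/-- A potential that increases along the non-matching edges, directed from the first color class
to the second, certifies that the perfect matching is unique. -/
lemma isUniquePM_of_potential {H : SimpleGraph V} (c : G.Coloring Bool) (φ : V → ℕ) (hHG : H ≤ G)
    (h : IsPM H μ) (hφ : ∀ v, φ (μ v) = φ v)
    (hinc : ∀ x y, H.Adj x y → c x = true → y ≠ μ x → φ x < φ y) : IsUniquePM H μ := by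
  refine ⟨h, fun μ' h' => ?_⟩
  by_contra hne
  obtain ⟨v, hv⟩ := Function.ne_iff.1 hne
  have hA : {v | c v = true ∧ μ' v ≠ μ v}.Nonempty := by
    by_cases hcv : c v = true
    · exact ⟨v, hcv, hv⟩
    · refine ⟨μ v, ?_, fun e => hv ?_⟩
      · have := c.valid (hHG (h.adj v))
        revert this hcv
        cases c v <;> cases c (μ v) <;> simp
      · rw [h.invol] at e
        exact (h'.eq_comm.1 e).symm
  -- At a vertex of largest potential where the matchings differ, going along `μ'` and then `μ`
  -- reaches another such vertex, of larger potential.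
  obtain ⟨v, ⟨hcv, hv⟩, hmax⟩ := Set.exists_max_image _ φ (Set.toFinite _) hA
  have h1 := hinc v (μ' v) (h'.adj v) hcv hv
  have h2 := hmax (μ (μ' v)) ⟨?_, fun e => ?_⟩
  · rw [hφ] at h2
    omega
  · have e1 := c.valid (hHG (h'.adj v))
    have e2 := c.valid (hHG (h.adj (μ' v)))
    revert e1 e2 hcv
    cases c v <;> cases c (μ' v) <;> cases c (μ (μ' v)) <;> simp
  · rw [h.invol] at e
    exact hv (h.eq_comm.1 (h'.inj e))

end Bipartite

/-! ### Blocks and normal components -/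

section Nonseparable

variable {G : SimpleGraph V} {μ : V → V}

/-- Reachability in `spanningCoe` stays on the type `V`, which makes it comparable between different
subgraphs. -/
lemma subgraph_preconnected_iff {H : G.Subgraph} :
    H.Preconnected ↔ ∀ a ∈ H.verts, ∀ b ∈ H.verts, H.spanningCoe.Reachable a b := by
  rw [Subgraph.preconnected_iff]
  constructor
  · intro h a ha b hb
    exact (h ⟨a, ha⟩ ⟨b, hb⟩).map ⟨Subtype.val, fun hab => hab⟩
  · rintro h ⟨a, ha⟩ ⟨b, hb⟩
    obtain ⟨p⟩ := h a ha b hb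
    clear h
    induction p with
    | nil => exact Reachable.refl _
    | cons hadj p ih =>
      have hadj' : H.Adj _ _ := hadj
      exact (Adj.reachable (G := H.coe) (u := ⟨_, ha⟩) (v := ⟨_, hadj'.snd_mem⟩) hadj').trans
        (ih _ hb)

lemma subgraph_connected_iff {H : G.Subgraph} :
    H.Connected ↔ H.verts.Nonempty ∧
      ∀ a ∈ H.verts, ∀ b ∈ H.verts, H.spanningCoe.Reachable a b := by
  rw [Subgraph.connected_iff, subgraph_preconnected_iff, and_comm]

lemma isNonseparable_subgraphOfAdj {a b : V} (h : G.Adj a b) :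
    IsNonseparable (G.subgraphOfAdj h) := by
  refine ⟨Subgraph.subgraphOfAdj_connected h, fun v hv => ?_⟩
  rw [subgraph_preconnected_iff]
  rintro x ⟨hx, hxv⟩ y ⟨hy, hyv⟩
  have : x = y := by
    simp only [subgraphOfAdj_verts, Set.mem_insert_iff, Set.mem_singleton_iff] at hv hx hy hxv hyv
    grind
  rw [this]

lemma exists_adj_of_connected {K : G.Subgraph} (hK : K.Connected) {a c : V} (ha : a ∈ K.verts)
    (hc : c ∈ K.verts) (hac : a ≠ c) : ∃ b, K.Adj a b := by
  obtain ⟨p⟩ := (subgraph_connected_iff.1 hK).2 a ha c hc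
  cases p with
  | nil => exact absurd rfl hac
  | cons h _ => exact ⟨_, h⟩

lemma eq_subgraphOfAdj {K : G.Subgraph} {a b : V} (hab : K.Adj a b)
    (h : ∀ c ∈ K.verts, c = a ∨ c = b) : K = G.subgraphOfAdj hab.adj_sub := by
  ext x y
  · simp only [subgraphOfAdj_verts, Set.mem_insert_iff, Set.mem_singleton_iff]
    constructor
    · exact h x
    · rintro (rfl | rfl)
      · exact hab.fst_mem
      · exact hab.snd_mem
  · simp only [subgraphOfAdj_adj, Sym2.eq_iff]
    constructor
    · intro hxy
      have := hxy.adj_sub.ne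
      have h1 := h x hxy.fst_mem
      have h2 := h y hxy.snd_mem
      grind
    · rintro (⟨rfl, rfl⟩ | ⟨rfl, rfl⟩)
      · exact hab
      · exact hab.symm

/-- A nonseparable subgraph with at least three vertices contains no bridge of `G`. -/
lemma IsNonseparable.not_isBridge {K : G.Subgraph} (hK : IsNonseparable K) {a b c : V}
    (hab : K.Adj a b) (hc : c ∈ K.verts) (hca : c ≠ a) (hcb : c ≠ b) : ¬ G.IsBridge s(a, b) := by
  rw [isBridge_iff, not_not]
  have key : ∀ v ∈ ({a, b} : Set V), (K.deleteVerts {v}).spanningCoe ≤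
      G.deleteEdges {s(a, b)} := by
    intro v hv x y hxy
    have hxy' : (K.deleteVerts {v}).Adj x y := hxy
    rw [deleteEdges_adj]
    refine ⟨hxy'.adj_sub, fun e => ?_⟩
    have h1 := hxy'.fst_mem.2
    have h2 := hxy'.snd_mem.2
    rcases Sym2.eq_iff.1 e with ⟨rfl, rfl⟩ | ⟨rfl, rfl⟩ <;>
      · simp only [Set.mem_insert_iff, Set.mem_singleton_iff] at hv h1 h2
        grind
  -- Go from `a` to `c` avoiding `b`, then from `c` to `b` avoiding `a`; neither part uses the edge
  -- `ab`.
  have h1 := (subgraph_preconnected_iff.1 (hK.2 b hab.snd_mem) a ⟨hab.fst_mem, hab.adj_sub.ne⟩ c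
    ⟨hc, hcb⟩).mono (key b (by simp))
  have h2 := (subgraph_preconnected_iff.1 (hK.2 a hab.fst_mem) c ⟨hc, hca⟩ b
    ⟨hab.snd_mem, hab.adj_sub.ne'⟩).mono (key a (by simp))
  exact h1.trans h2

lemma IsNormalComponent.adj_of_mem {N : G.Subgraph} (hN : IsNormalComponent N) {v w : V}
    (hv : v ∈ N.verts) (hvw : (nonFixedSubgraph G).Adj v w) : N.Adj v w := by
  have hle : N ⊔ G.subgraphOfAdj hvw.1 ≤ N := hN.2 ⟨sup_le hN.1.1 ?_, ?_⟩ le_sup_left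
  · exact (le_sup_right.trans hle).2 (by simp)
  · constructor
    · rintro x (rfl | rfl)
      · exact hvw.fst_mem
      · exact hvw.snd_mem
    · intro x y hxy
      rw [subgraphOfAdj_adj, Sym2.eq_iff] at hxy
      obtain ⟨rfl, rfl⟩ | ⟨rfl, rfl⟩ := hxy
      · exact hvw
      · exact hvw.symm
  · exact Subgraph.connected_sup hN.1.2.preconnected
      (Subgraph.subgraphOfAdj_connected hvw.1).preconnected ⟨v, hv, by simp⟩

variable [Finite V]

lemma exists_isNormalComponent_ge {K : G.Subgraph} (hK : K ≤ nonFixedSubgraph G)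
    (hc : K.Connected) : ∃ N, IsNormalComponent N ∧ K ≤ N := by
  obtain ⟨N, h1, h2⟩ := (Set.toFinite
    {K : G.Subgraph | K ≤ nonFixedSubgraph G ∧ K.Connected}).exists_le_maximal
    (show K ∈ _ from ⟨hK, hc⟩)
  exact ⟨N, h2, h1⟩

lemma exists_isBlock_ge {K : G.Subgraph} (hK : IsNonseparable K) : ∃ B, IsBlock B ∧ K ≤ B := by
  obtain ⟨N, h1, h2⟩ := (Set.toFinite
    {K : G.Subgraph | IsNonseparable K}).exists_le_maximal (show K ∈ _ from hK)
  exact ⟨N, h2, h1⟩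

/-- Normal components have no cut vertices, as soon as there is a perfect matching. -/
lemma IsNormalComponent.isNonseparable {N : G.Subgraph} (hN : IsNormalComponent N)
    (hμ : IsPM G μ) : IsNonseparable N := by
  refine ⟨hN.1.2, fun v hv => ?_⟩
  set K := (N.deleteVerts {v}).spanningCoe with hKdef
  have hK : ∀ a b, N.Adj a b → a ≠ v → b ≠ v → K.Adj a b := fun a b hab ha hb => by
    rw [hKdef, Subgraph.spanningCoe_adj, Subgraph.deleteVerts_adj]
    exact ⟨hab.fst_mem, ha, hab.snd_mem, hb, hab⟩
  have hKN : ∀ a b, K.Adj a b → N.Adj a b ∧ a ≠ v ∧ b ≠ v := fun a b hab => by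
    rw [hKdef, Subgraph.spanningCoe_adj, Subgraph.deleteVerts_adj] at hab
    exact ⟨hab.2.2.2.2, hab.2.1, hab.2.2.2.1⟩
  have hpm : ∀ μ', IsPM G μ' → ∀ q ∈ N.verts, N.Adj q (μ' q) := fun μ' h' q hq =>
    hN.adj_of_mem hq (nonFixedSubgraph_adj_of_mem h' (hN.1.1.1 hq))
  -- Some perfect matching `μ'` uses the non-fixed edge `vx`. If the component of `x` in `N - v`
  -- missed `μ v`, it would be closed under `μ`, and closed under `μ'` except at `x`. So all
  -- neighbors of `v` lie in the component of `μ v`.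
  have hnbr : ∀ x, N.Adj v x → K.Reachable x (μ v) := by
    intro x hvx
    by_contra hcon
    obtain ⟨⟨μ', h', e⟩, -⟩ := (not_isFixedEdge_iff hvx.adj_sub).1 (hN.1.1.2 hvx).2
    have hX : ∀ q, K.Reachable x q → q ∈ N.verts ∧ q ≠ v := by
      intro q hq
      obtain ⟨p⟩ := hq.symm
      cases p with
      | nil => exact ⟨hvx.snd_mem, hvx.adj_sub.ne'⟩
      | cons hadj p => exact ⟨(hKN _ _ hadj).1.fst_mem, (hKN _ _ hadj).2.1⟩
    have e' : μ' x = v := by rw [← e, h'.invol]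
    refine parity_obstruction hμ h' {q | K.Reachable x q} (x := x) (Reachable.refl _) ?_ ?_ ?_
    · intro q hq
      obtain ⟨h1, h2⟩ := hX q hq
      refine Reachable.trans hq (Adj.reachable (hK _ _ (hpm μ hμ q h1) h2 fun e3 => hcon ?_))
      rw [← e3, hμ.invol]
      exact hq
    · intro q hq hqx
      obtain ⟨h1, h2⟩ := hX q hq
      refine Reachable.trans hq (Adj.reachable (hK _ _ (hpm μ' h' q h1) h2 fun e3 => hqx ?_))
      exact h'.inj (by rw [e3, e'])
    · intro hq
      exact (hX _ hq).2 e'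
  have key : ∀ u, N.spanningCoe.Reachable u v → u ≠ v → K.Reachable u (μ v) := by
    rintro u ⟨p⟩
    induction p with
    | nil => exact fun h => absurd rfl h
    | @cons u w v hadj p ih =>
      intro huv
      by_cases hw : w = v
      · subst hw
        exact hnbr _ (Subgraph.Adj.symm hadj)
      · exact (Adj.reachable (hK _ _ hadj huv hw)).trans (ih hv hKdef hK hKN hnbr hw)
  have hconn := (subgraph_connected_iff.1 hN.1.2).2
  rw [subgraph_preconnected_iff]
  rintro a ⟨ha, hav⟩ b ⟨hb, hbv⟩
  exact (key a (hconn a ha v hv) hav).trans (key b (hconn b hb v hv) hbv).symm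

omit [Finite V] in
lemma IsBlock.exists_adj {B : G.Subgraph} (hB : IsBlock B) (hμ : IsPM G μ) :
    ∃ a b, B.Adj a b := by
  by_contra! hcon
  obtain ⟨v, hv⟩ := hB.1.1.nonempty
  have hle : B ≤ G.subgraphOfAdj (hμ.adj v) := by
    refine ⟨fun w hw => ?_, fun a b hab => absurd hab (hcon a b)⟩
    by_cases hvw : w = v
    · simp [hvw]
    · obtain ⟨b, hb⟩ := exists_adj_of_connected hB.1.1 hw hv hvw
      exact absurd hb (hcon _ _)
  exact hcon v (μ v) ((hB.2 (isNonseparable_subgraphOfAdj (hμ.adj v)) hle).2 (by simp))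

/-- The blocks of a rigid graph are its fixed edges and its normal components. -/
lemma Rigid.isBlock_cases (hr : Rigid G μ) {B : G.Subgraph} (hB : IsBlock B) :
    (∃ (a b : V) (h : G.Adj a b), IsFixedEdge G s(a, b) ∧ B = G.subgraphOfAdj h) ∨
      IsNormalComponent B := by
  obtain ⟨a, b, hab⟩ := hB.exists_adj hr.1
  rw [or_iff_not_imp_left]
  intro hnf
  have hBle : ∀ x y, B.Adj x y → (nonFixedSubgraph G).Adj x y := by
    intro x y hxy
    by_cases hc : ∃ c ∈ B.verts, c ≠ x ∧ c ≠ y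
    · obtain ⟨c, hc, h1, h2⟩ := hc
      exact hr.nonFixedSubgraph_adj.2 ⟨hxy.adj_sub, hB.1.not_isBridge hxy hc h1 h2⟩
    · push Not at hc
      refine ⟨hxy.adj_sub, fun hf => hnf ⟨x, y, hxy.adj_sub, hf, eq_subgraphOfAdj hxy ?_⟩⟩
      intro c hcB
      have := hc c hcB
      tauto
  have hle : B ≤ nonFixedSubgraph G := by
    refine ⟨fun x hx => ?_, hBle⟩
    by_cases hxa : x = a
    · subst hxa; exact (hBle _ _ hab).fst_mem
    · obtain ⟨y, hy⟩ := exists_adj_of_connected hB.1.1 hx hab.fst_mem hxa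
      exact (hBle _ _ hy).fst_mem
  obtain ⟨N, hN, hBN⟩ := exists_isNormalComponent_ge hle hB.1.1
  rwa [le_antisymm hBN (hB.2 (hN.isNonseparable hr.1) hBN)]

end Nonseparable

end AntiForcing

/-! ### Alternating walks and the ears they produce -/

namespace AntiForcing

variable {V : Type*}

/-- A rank function measuring the distance to `T` along `r`. -/
lemma exists_rank {α : Type*} (r : α → α → Prop) (T : Set α) :
    ∃ n : α → ℕ, (∀ v ∈ T, n v = 0) ∧ ∀ v ∉ T, (∃ t ∈ T, ReflTransGen r v t) →
      ∃ q, r v q ∧ n q < n v ∧ ∃ t ∈ T, ReflTransGen r q t := by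
  -- `W k v` says that `T` is reached from `v` in exactly `k` steps. The rank is the least such `k`,
  -- with default `0` where `T` is out of reach.
  let W : ℕ → α → Prop := fun k => k.rec (fun v => v ∈ T) fun _ P v => ∃ q, r v q ∧ P q
  have hW : ∀ v, (∃ t ∈ T, ReflTransGen r v t) → ∃ k, W k v := by
    rintro v ⟨t, ht, h⟩
    induction h using ReflTransGen.head_induction_on with
    | refl => exact ⟨0, ht⟩
    | head h _ ih =>
      obtain ⟨k, hk⟩ := ih
      exact ⟨k + 1, _, h, hk⟩
  have hW' : ∀ k v, W k v → ∃ t ∈ T, ReflTransGen r v t := by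
    intro k
    induction k with
    | zero => exact fun v hv => ⟨v, hv, .refl⟩
    | succ k ih =>
      rintro v ⟨q, hq, hk⟩
      obtain ⟨t, ht, h⟩ := ih q hk
      exact ⟨t, ht, .head hq h⟩
  refine ⟨fun v => sInf {k | W k v}, fun v hv => ?_, fun v hv hr => ?_⟩
  · exact Nat.sInf_eq_zero.2 (Or.inl hv)
  · have hm : W (sInf {k | W k v}) v := Nat.sInf_mem (hW v hr)
    rcases hk : sInf {k | W k v} with _ | k
    · rw [hk] at hm
      exact absurd hm hv
    · rw [hk] at hm
      obtain ⟨q, hq, hWq⟩ := hm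
      exact ⟨q, hq, by
        simp only [hk]
        exact Nat.lt_succ_of_le (Nat.sInf_le hWq), hW' k q hWq⟩

variable {G : SimpleGraph V} {μ : V → V}

/-- One step of an alternating walk in `K`: a non-matching edge followed by the matching edge that
ends at `b'`. -/
def Step (μ : V → V) (K : G.Subgraph) (b b' : V) : Prop :=
  K.Adj b (μ b') ∧ b ≠ b'

lemma reach_mono {K L : G.Subgraph} (h : K ≤ L) {a b : V} (hab : ReflTransGen (Step μ K) a b) :
    ReflTransGen (Step μ L) a b :=
  ReflTransGen.mono (fun _ _ h' => ⟨h.2 h'.1, h'.2⟩) _ _ hab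

/-- Reversing an alternating walk replaces both of its ends by their partners. -/
lemma reach_flip (hμ : IsPM G μ) {K : G.Subgraph} {a b : V}
    (hab : ReflTransGen (Step μ K) a b) : ReflTransGen (Step μ K) (μ b) (μ a) := by
  induction hab with
  | refl => exact .refl
  | tail _ h ih => exact .head ⟨by rw [hμ.invol]; exact h.1.symm, fun e => h.2 (hμ.inj e).symm⟩ ih

lemma bool_eq_of_ne_of_ne {a b d : Bool} (h : a ≠ b) (h' : b ≠ d) : a = d := by
  cases a <;> cases b <;> cases d <;> simp_all

lemma Step.color_eq (hμ : IsPM G μ) (c : G.Coloring Bool) {K : G.Subgraph} {a b : V}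
    (h : Step μ K a b) : c a = c b :=
  bool_eq_of_ne_of_ne (c.valid h.1.adj_sub) (c.valid (hμ.adj b)).symm

lemma reach_color_eq (hμ : IsPM G μ) (c : G.Coloring Bool) {K : G.Subgraph} {a b : V}
    (hab : ReflTransGen (Step μ K) a b) : c a = c b := by
  induction hab with
  | refl => rfl
  | tail _ h ih => exact ih.trans (h.color_eq hμ c)

/-- Non-matching non-fixed edges lie on alternating cycles. -/
lemma reach_nonFixedSubgraph [Finite V] (hμ : IsPM G μ) {x y : V}
    (h : (nonFixedSubgraph G).Adj x y) : ReflTransGen (Step μ (nonFixedSubgraph G)) (μ y) x := by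
  obtain ⟨⟨μ', h', rfl⟩, -⟩ := (not_isFixedEdge_iff h.1).1 h.2
  -- The orbits of `π` trace the symmetric difference of `μ` and `μ'`. The target `x` is reached
  -- from `π x = μ y` by the remaining `orderOf π - 1` applications.
  let π : Equiv.Perm V := (Function.Involutive.toPerm μ' h'.invol).trans
    (Function.Involutive.toPerm μ hμ.invol)
  have hπ : ∀ v, π v = μ (μ' v) := fun v => rfl
  have hmem : ∀ v ∈ (nonFixedSubgraph G).verts, π v ∈ (nonFixedSubgraph G).verts := fun v hv =>
    (nonFixedSubgraph_adj_of_mem hμ (nonFixedSubgraph_adj_of_mem h' hv).snd_mem).snd_mem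
  have hstep : ∀ v ∈ (nonFixedSubgraph G).verts,
      ReflTransGen (Step μ (nonFixedSubgraph G)) v (π v) := by
    intro v hv
    by_cases e : v = π v
    · rw [← e]
    · exact .single ⟨by rw [hπ, hμ.invol]; exact nonFixedSubgraph_adj_of_mem h' hv, e⟩
  have hiter : ∀ n : ℕ, ∀ v ∈ (nonFixedSubgraph G).verts,
      ReflTransGen (Step μ (nonFixedSubgraph G)) v ((π ^ n) v) := by
    intro n
    induction n with
    | zero => exact fun v _ => .refl
    | succ n ih =>
      intro v hv
      rw [pow_succ, Equiv.Perm.mul_apply]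
      exact (hstep v hv).trans (ih _ (hmem v hv))
  have hfin : 0 < orderOf π := orderOf_pos π
  have := hiter (orderOf π - 1) (π x) (hmem x h.fst_mem)
  rwa [← Equiv.Perm.mul_apply, ← pow_succ, Nat.sub_add_cancel hfin, pow_orderOf_eq_one] at this

lemma reach_nonFixedSubgraph_symm [Finite V] (hμ : IsPM G μ) {a b : V}
    (h : ReflTransGen (Step μ (nonFixedSubgraph G)) a b) :
    ReflTransGen (Step μ (nonFixedSubgraph G)) b a := by
  induction h with
  | refl => exact .refl
  | tail _ h ih =>
    have := reach_nonFixedSubgraph hμ h.1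
    rw [hμ.invol] at this
    exact this.trans ih

/-- `K` is closed under the matching, and within each normal component its vertices of the first
color class reach each other along alternating walks in `K`. -/
structure Good (μ : V → V) (c : G.Coloring Bool) (K : G.Subgraph) : Prop where
  closed : ∀ v ∈ K.verts, K.Adj v (μ v)
  reach : ∀ a ∈ K.verts, ∀ b ∈ K.verts, c a = true →
    ReflTransGen (Step μ (nonFixedSubgraph G)) a b → ReflTransGen (Step μ K) a b

/-- The coloring with exchanged colors. -/
def swapColoring (c : G.Coloring Bool) : G.Coloring Bool :=
  Coloring.mk (fun v => !c v) fun h e => c.valid h (by simpa using e)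

lemma swapColoring_apply (c : G.Coloring Bool) (v : V) : swapColoring c v = !c v := rfl

/-- `reach_flip` carries the condition from one color class to the other, so ears may start in
either class. -/
lemma Good.swap (hμ : IsPM G μ) {c : G.Coloring Bool} {K : G.Subgraph} (h : Good μ c K) :
    Good μ (swapColoring c) K := by
  refine ⟨h.closed, fun a ha b hb hc hab => ?_⟩
  have h1 := h.reach (μ b) (h.closed b hb).snd_mem (μ a) (h.closed a ha).snd_mem ?_
    (reach_flip hμ hab)
  · have := reach_flip hμ h1
    rwa [hμ.invol, hμ.invol] at this
  · have e1 := reach_color_eq hμ c hab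
    have e2 := c.valid (hμ.adj b)
    rw [swapColoring_apply] at hc
    revert e1 e2 hc
    cases c a <;> cases c b <;> cases c (μ b) <;> simp

/-- The matching representative of `v` in the first color class. -/
def rep (μ : V → V) (c : G.Coloring Bool) (v : V) : V := if c v = true then v else μ v

lemma rep_of_true {c : G.Coloring Bool} {v : V} (h : c v = true) : rep μ c v = v := if_pos h

lemma rep_apply_of_true (hμ : IsPM G μ) {c : G.Coloring Bool} {v : V} (h : c v = true) :
    rep μ c (μ v) = v := by
  have := c.valid (hμ.adj v)
  rw [rep, if_neg (by rw [h] at this; exact this.symm), hμ.invol]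

lemma rep_apply (hμ : IsPM G μ) (c : G.Coloring Bool) (v : V) :
    rep μ c (μ v) = rep μ c v := by
  by_cases h : c v = true
  · rw [rep_apply_of_true hμ h, rep_of_true h]
  · have := c.valid (hμ.adj v)
    have h' : c (μ v) = true := by
      revert h this
      cases c v <;> cases c (μ v) <;> simp
    rw [rep_of_true h', rep, if_neg h]

/-- The edges outside `K` along which the rank decreases on the way to `z`. -/
structure ContainsExits (μ : V → V) (c : G.Coloring Bool) (K : G.Subgraph) (n : V → ℕ) (z : V)
    (H : SimpleGraph V) : Prop where
  matching : ∀ q ∉ K.verts, H.Adj q (μ q)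
  -- Of the descending edges that return to `K`, only those ending at `z` are required.
  descent : ∀ a ∉ K.verts, c a = true → ∀ q, (nonFixedSubgraph G).Adj a (μ q) → a ≠ q →
    n q < n a → (q ∉ K.verts ∨ μ q = z) → H.Adj a (μ q)

/-- A shortest alternating walk from `u` back to `K`. -/
lemma exists_exit_walk (hμ : IsPM G μ) (c : G.Coloring Bool) {K : G.Subgraph}
    (hK : ∀ v ∈ K.verts, K.Adj v (μ v)) (n : V → ℕ)
    (hn : ∀ v ∉ K.verts, (∃ t ∈ K.verts, ReflTransGen (Step μ (nonFixedSubgraph G)) v t) →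
      ∃ q, Step μ (nonFixedSubgraph G) v q ∧ n q < n v ∧
        ∃ t ∈ K.verts, ReflTransGen (Step μ (nonFixedSubgraph G)) q t) :
    ∀ k u, n u = k → u ∉ K.verts → c u = true →
      (∃ t ∈ K.verts, ReflTransGen (Step μ (nonFixedSubgraph G)) u t) →
      ∃ z ∈ K.verts, ∃ W : G.Walk u z, W.IsPath ∧ Odd W.length ∧
        (∀ q ∈ W.support, q ∈ K.verts → q = z) ∧
        (∀ q ∈ W.support, q ∉ K.verts → q ≠ u → s(q, μ q) ∈ W.edges) ∧
        μ u ∉ W.support ∧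
        (∀ q ∈ W.support, q ∉ K.verts → n (rep μ c q) ≤ n u) ∧
        (∀ a b, W.toSubgraph.Adj a b → (nonFixedSubgraph G).Adj a b ∧ ¬ K.Adj a b) ∧
        (ReflTransGen (Step μ W.toSubgraph) u (μ z)) ∧
        (∀ q ∈ W.support, q ∉ K.verts → c q = true →
          ReflTransGen (Step μ W.toSubgraph) u q ∧
          ReflTransGen (Step μ W.toSubgraph) q (μ z)) ∧
        ∀ H, ContainsExits μ c K n z H → H.Reachable u z := by
  intro k
  -- Take a step to some `q` of smaller rank. If `q` is in `K`, the walk stops at `z = μ q`;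
  -- otherwise it runs through `μ q` and `q` and continues by induction.
  induction k using Nat.strong_induction_on with | _ k ih
  intro u hk hu hcu hreach
  have hμu : μ u ∉ K.verts := fun h => hu (by have := (hK _ h).snd_mem; rwa [hμ.invol] at this)
  obtain ⟨q, ⟨hadj, huq⟩, hlt, hq⟩ := hn u hu hreach
  have hcq : c q = true := by
    rw [← hcu]; exact (Step.color_eq hμ c (⟨hadj, huq⟩ : Step μ (nonFixedSubgraph G) u q)).symm
  have hGadj : G.Adj u (μ q) := hadj.1
  by_cases hqK : q ∈ K.verts
  · have hz : μ q ∈ K.verts := (hK q hqK).snd_mem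
    have hstep : Step μ (Walk.cons hGadj Walk.nil).toSubgraph u q := ⟨by simp, huq⟩
    refine ⟨μ q, hz, Walk.cons hGadj Walk.nil, by simpa using hGadj.ne, by simp, ?_, ?_, ?_, ?_, ?_,
      ?_, ?_, ?_⟩
    · intro p hp hpK
      simp only [Walk.support_cons, Walk.support_nil, List.mem_cons, List.not_mem_nil,
        or_false] at hp
      rcases hp with rfl | rfl
      · exact absurd hpK hu
      · rfl
    · intro p hp hpK hpu
      simp only [Walk.support_cons, Walk.support_nil, List.mem_cons, List.not_mem_nil,
        or_false] at hp
      rcases hp with rfl | rfl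
      · exact absurd rfl hpu
      · exact absurd hz hpK
    · simp only [Walk.support_cons, Walk.support_nil, List.mem_cons, List.not_mem_nil,
        or_false, not_or]
      exact ⟨hμ.ne u, fun e => huq (hμ.inj e)⟩
    · intro p hp hpK
      simp only [Walk.support_cons, Walk.support_nil, List.mem_cons, List.not_mem_nil,
        or_false] at hp
      rcases hp with rfl | rfl
      · rw [rep_of_true hcu]
      · exact absurd hz hpK
    · intro a b hab
      simp only [Walk.adj_toSubgraph_iff_mem_edges, Walk.edges_cons, Walk.edges_nil,
        List.mem_singleton, Sym2.eq_iff] at hab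
      rcases hab with ⟨rfl, rfl⟩ | ⟨rfl, rfl⟩
      · exact ⟨hadj, fun h => hu h.fst_mem⟩
      · exact ⟨hadj.symm, fun h => hu h.snd_mem⟩
    · rw [hμ.invol]; exact .single hstep
    · intro p hp hpK hcp
      simp only [Walk.support_cons, Walk.support_nil, List.mem_cons, List.not_mem_nil,
        or_false] at hp
      rcases hp with rfl | rfl
      · exact ⟨.refl, by rw [hμ.invol]; exact .single hstep⟩
      · exact absurd hz hpK
    · intro H hH
      exact (hH.descent u hu hcu q hadj huq hlt (Or.inr rfl)).reachable
  · obtain ⟨z, hz, W, h1, h2, h3, h4, h5, h6, h7, h8, h9, h10⟩ :=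
      ih (n q) (hk ▸ hlt) q rfl hqK hcq hq
    have hμq : μ q ∉ K.verts := fun h => hqK (by have := (hK _ h).snd_mem; rwa [hμ.invol] at this)
    have hGadj' : G.Adj (μ q) q := (hμ.adj q).symm
    have hnfq : (nonFixedSubgraph G).Adj (μ q) q := (nonFixedSubgraph_adj_of_mem hμ (by
      have := nonFixedSubgraph_adj_of_mem hμ hadj.snd_mem
      rw [hμ.invol] at this
      exact this.snd_mem)).symm
    set W' := Walk.cons hGadj (Walk.cons hGadj' W) with hW'
    have hsup : ∀ p, p ∈ W'.support ↔ p = u ∨ p = μ q ∨ p ∈ W.support := by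
      intro p; simp [hW']
    have hedge : ∀ e, e ∈ W'.edges ↔ e = s(u, μ q) ∨ e = s(μ q, q) ∨ e ∈ W.edges := by
      intro e; simp [hW']
    have hWle : W.toSubgraph ≤ W'.toSubgraph := by
      rw [hW']
      simp only [Walk.toSubgraph]
      exact le_sup_right.trans le_sup_right
    -- Outside `K` the ranks on the rest of the walk are at most `n q < n u`; this keeps the walk a
    -- path.
    have huW : u ∉ W.support := fun h => by
      have := h6 u h hu
      rw [rep_of_true hcu] at this
      omega
    have hμuW : μ u ∉ W.support := fun h => by
      have := h6 (μ u) h hμu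
      rw [rep_apply_of_true hμ hcu] at this
      omega
    have hstep : Step μ W'.toSubgraph u q :=
      ⟨by rw [Walk.adj_toSubgraph_iff_mem_edges, hedge]; exact Or.inl rfl, huq⟩
    have hqz := reach_mono hWle h8
    refine ⟨z, hz, W', ?_, ?_, ?_, ?_, ?_, ?_, ?_, ?_, ?_, ?_⟩
    · rw [hW', Walk.cons_isPath_iff, Walk.cons_isPath_iff, Walk.support_cons, List.mem_cons, not_or]
      exact ⟨⟨h1, h5⟩, hGadj.ne, huW⟩
    · simp only [hW', Walk.length_cons]
      grind
    · intro p hp hpK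
      rcases (hsup p).1 hp with rfl | rfl | hp
      · exact absurd hpK hu
      · exact absurd hpK hμq
      · exact h3 p hp hpK
    · intro p hp hpK hpu
      rw [hedge]
      rcases (hsup p).1 hp with rfl | rfl | hp
      · exact absurd rfl hpu
      · rw [hμ.invol]; exact Or.inr (Or.inl rfl)
      · by_cases hpq : p = q
        · rw [hpq]; exact Or.inr (Or.inl Sym2.eq_swap)
        · exact Or.inr (Or.inr (h4 p hp hpK hpq))
    · rw [hsup]
      rintro (h | h | h)
      · exact hμ.ne u h
      · exact huq (hμ.inj h)
      · exact hμuW h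
    · intro p hp hpK
      rcases (hsup p).1 hp with rfl | rfl | hp
      · rw [rep_of_true hcu]
      · rw [rep_apply_of_true hμ hcq]; exact hlt.le
      · exact (h6 p hp hpK).trans hlt.le
    · intro a b hab
      rw [Walk.adj_toSubgraph_iff_mem_edges, hedge, Sym2.eq_iff, Sym2.eq_iff] at hab
      rcases hab with (⟨rfl, rfl⟩ | ⟨rfl, rfl⟩) | (⟨rfl, rfl⟩ | ⟨rfl, rfl⟩) | hab
      · exact ⟨hadj, fun h => hu h.fst_mem⟩
      · exact ⟨hadj.symm, fun h => hu h.snd_mem⟩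
      · exact ⟨hnfq, fun h => hqK h.snd_mem⟩
      · exact ⟨hnfq.symm, fun h => hqK h.fst_mem⟩
      · exact h7 a b (Walk.adj_toSubgraph_iff_mem_edges.2 hab)
    · exact .head hstep hqz
    · intro p hp hpK hcp
      rcases (hsup p).1 hp with rfl | rfl | hp
      · exact ⟨.refl, .head hstep hqz⟩
      · have := c.valid (hμ.adj q)
        rw [hcq, hcp] at this
        exact absurd rfl this
      · obtain ⟨i1, i2⟩ := h9 p hp hpK hcp
        exact ⟨.head hstep (reach_mono hWle i1), reach_mono hWle i2⟩
    · intro H hH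
      exact ((hH.descent u hu hcu q hadj huq hlt (Or.inl hqK)).reachable.trans
        (hH.matching q hqK).symm.reachable).trans (h10 H hH)

/-- In a rigid graph, an alternating walk that leaves `K` at `x` returns at the partner of `x`. -/
lemma Rigid.exit_eq [Finite V] (hr : Rigid G μ) {c : G.Coloring Bool} {K : G.Subgraph}
    (hK : Good μ c K) (n : V → ℕ) {x y z : V} (hx : x ∈ K.verts) (hz : z ∈ K.verts)
    (hcx : c x = true) (hxy : G.Adj x y) (hxyK : ¬ K.Adj x y)
    (hyz : y ∈ K.verts → y = z)
    (hnf : ReflTransGen (Step μ (nonFixedSubgraph G)) x (μ z))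
    (hH : ∀ H, ContainsExits μ c K n z H → H.Reachable y z) : z = μ x := by
  classical
  have hμ := hr.1
  -- The plan is a uniquely matched `H` with a cycle through `xy`: from `x` inside `K` to `b`,
  -- across the matching edge to `z`, and back to `y` along the exit edges.
  by_contra hne
  set b := μ z with hb
  have hbz : μ b = z := hμ.invol z
  have hbK : b ∈ K.verts := (hK.closed z hz).snd_mem
  have hbx : b ≠ x := fun e => hne (by rw [← e, hbz])
  have hyx : y ≠ μ x := fun e => hxyK (e ▸ hK.closed x hx)
  have hreach := hK.reach x hx b hbK hcx hnf
  have hcb : c b = true := by rw [← reach_color_eq hμ c hreach, hcx]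
  -- The relation is reversed, so `d` is the alternating distance from `x` inside `K`.
  obtain ⟨d, hd0, hd⟩ := exists_rank (fun a b => Step μ K b a) {x}
  have hd' : ∀ v, v ≠ x → ReflTransGen (Step μ K) x v → ∃ q, Step μ K q v ∧ d q < d v ∧
      ReflTransGen (Step μ K) x q := by
    intro v hv hxv
    obtain ⟨q, h1, h2, t, rfl, h3⟩ := hd v hv ⟨x, rfl, reflTransGen_swap.2 hxv⟩
    exact ⟨q, h1, h2, reflTransGen_swap.1 h3⟩
  have hdb : 0 < d b := by
    obtain ⟨q, -, h, -⟩ := hd' b hbx hreach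
    omega
  obtain ⟨L, hL⟩ : ∃ L, ∀ v, n v < L := by
    obtain ⟨L, hL⟩ := (Set.finite_range n).bddAbove
    exact ⟨L + 1, fun v => Nat.lt_succ_of_le (hL ⟨v, rfl⟩)⟩
  -- In `K` the potential grows with the distance from `x`, starting at `0`; outside it grows as the
  -- rank falls, staying in `[1, L]`. An exit edge back to `z` also increases it: its start has
  -- positive rank, hence potential below `L`, and `L ≤ L * d b`.
  let ψ : V → ℕ := fun v => if v ∈ K.verts then L * d v else L - n v
  let φ : V → ℕ := fun v => ψ (rep μ c v)
  have hφt : ∀ v, c v = true → φ v = ψ v := fun v hv => by simp only [φ, rep_of_true hv]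
  have hφμ : ∀ v, φ (μ v) = φ v := fun v => by simp only [φ, rep_apply hμ]
  have hφ' : ∀ v, c v = true → φ (μ v) = ψ v := fun v hv => by rw [hφμ, hφt v hv]
  have hψK : ∀ v ∈ K.verts, ψ v = L * d v := fun v hv => if_pos hv
  have hψn : ∀ v ∉ K.verts, ψ v = L - n v := fun v hv => if_neg hv
  let H : SimpleGraph V :=
    { Adj := fun a b => b = μ a ∨ G.Adj a b ∧
        ((c a = true ∧ φ a < φ b) ∨ (c b = true ∧ φ b < φ a))
      symm := ⟨by
        rintro a b (rfl | ⟨h1, h2⟩)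
        · exact Or.inl (hμ.invol a).symm
        · exact Or.inr ⟨h1.symm, h2.symm⟩⟩
      loopless := ⟨fun a h => h.elim (fun e => hμ.ne a e.symm) fun h => h.1.ne rfl⟩ }
  have hHG : H ≤ G := by
    rintro a b (rfl | ⟨h1, -⟩)
    · exact hμ.adj a
    · exact h1
  have huniq : IsUniquePM H μ := by
    refine isUniquePM_of_potential c φ hHG ⟨fun v => Or.inl rfl, hμ.invol⟩ hφμ ?_
    rintro a b (h | ⟨h1, ⟨-, h⟩ | ⟨h, -⟩⟩) hca hab
    · exact absurd h hab
    · exact h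
    · exact absurd (hca.trans h.symm) (c.valid h1)
  have hbr := isAcyclic_iff_forall_adj_isBridge.1 (hr.2 H hHG huniq)
  set H' := H.deleteEdges {s(x, y)} with hH'
  have hcy : c y = false := by
    have := c.valid hxy
    rw [hcx] at this
    simpa using this.symm
  have hHm : ∀ v, H'.Adj v (μ v) := fun v => by
    rw [hH', deleteEdges_adj]
    refine ⟨Or.inl rfl, fun e => ?_⟩
    rcases Sym2.eq_iff.1 e with ⟨rfl, e'⟩ | ⟨rfl, e'⟩
    · exact hyx e'.symm
    · exact hyx (hμ.eq_comm.1 e')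
  have hcμ : ∀ v, c v = true → c (μ v) = false := fun v hv => by
    have := c.valid (hμ.adj v)
    rw [hv] at this
    simpa using this.symm
  have hrepy : c (μ y) = true := by
    have := c.valid (hμ.adj y)
    rw [hcy] at this
    simpa using this.symm
  have hHxy : H.Adj x y := by
    refine Or.inr ⟨hxy, Or.inl ⟨hcx, ?_⟩⟩
    rw [hφt x hcx, hψK x hx, hd0 x rfl, mul_zero, ← hφμ y, hφt _ hrepy]
    by_cases hy : y ∈ K.verts
    · rw [hyz hy, hψK _ hbK]
      exact Nat.mul_pos (by have := hL x; omega) hdb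
    · rw [hψn]
      · have := hL (μ y); omega
      · intro h
        have := (hK.closed _ h).snd_mem
        rw [hμ.invol] at this
        exact hy this
  have hKreach : ∀ k v, d v = k → ReflTransGen (Step μ K) x v → H'.Reachable x v := by
    intro k
    induction k using Nat.strong_induction_on with | _ k ih
    intro v hk hv
    by_cases hvx : v = x
    · rw [hvx]
    · obtain ⟨q, hqv, hlt, hq⟩ := hd' v hvx hv
      have hcv : c v = true := by rw [← reach_color_eq hμ c hv, hcx]
      have hcq : c q = true := by rw [← reach_color_eq hμ c hq, hcx]
      have hadj : H'.Adj q (μ v) := by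
        rw [hH', deleteEdges_adj]
        refine ⟨Or.inr ⟨hqv.1.adj_sub, Or.inl ⟨hcq, ?_⟩⟩, fun e => ?_⟩
        · have hvK : v ∈ K.verts := by
            have := (hK.closed _ hqv.1.snd_mem).snd_mem
            rwa [hμ.invol] at this
          rw [hφt q hcq, hφ' v hcv, hψK q hqv.1.fst_mem, hψK v hvK]
          exact Nat.mul_lt_mul_of_pos_left hlt (by have := hL x; omega)
        · have h1 : s(q, μ v) = s(x, y) := e
          exact hxyK ((Subgraph.mem_edgeSet).1 (h1 ▸ (Subgraph.mem_edgeSet).2 hqv.1))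
      exact ((ih (d q) (hk ▸ hlt) q rfl hq).trans hadj.reachable).trans (hHm v).symm.reachable
  have hexit : ContainsExits μ c K n z H' := by
    refine ⟨fun q _ => hHm q, fun a ha hca q hnfa haq hlt hor => ?_⟩
    have hcq : c q = true := by
      rw [← hca]; exact (Step.color_eq hμ c (⟨hnfa, haq⟩ : Step μ (nonFixedSubgraph G) a q)).symm
    rw [hH', deleteEdges_adj]
    refine ⟨Or.inr ⟨hnfa.1, Or.inl ⟨hca, ?_⟩⟩, fun e => ?_⟩
    · rw [hφt a hca, hφ' q hcq, hψn a ha]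
      have h1 := hL a
      rcases hor with hq | hq
      · rw [hψn q hq]; omega
      · have hqb : q = b := by rw [hb, ← hq, hμ.invol]
        rw [hqb, hψK b hbK]
        have := Nat.le_mul_of_pos_right L hdb
        omega
    · rcases Sym2.eq_iff.1 e with ⟨rfl, _⟩ | ⟨rfl, _⟩
      · exact ha hx
      · rw [hcy] at hca
        exact Bool.false_ne_true hca
  have h1 := hKreach _ b rfl hreach
  have h2 := hHm b
  rw [hbz] at h2
  exact (isBridge_iff.1 (hbr hHxy)) ((h1.trans h2.reachable).trans (hH H' hexit).symm)

/-- An alternating ear `P` on `K` joining a vertex to its partner. -/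
structure IsAltEar (μ : V → V) (K : G.Subgraph) {x : V} (P : G.Walk x (μ x)) : Prop where
  isPath : P.IsPath
  odd_length : Odd P.length
  mem : x ∈ K.verts
  inner : ∀ q ∈ P.support, q ∈ K.verts → q = x ∨ q = μ x
  matched : ∀ q ∈ P.support, q ∉ K.verts → s(q, μ q) ∈ P.edges
  nonFixed : ∀ a b, P.toSubgraph.Adj a b → (nonFixedSubgraph G).Adj a b ∧ ¬ K.Adj a b

/-- In a rigid graph, a non-fixed edge leaving `K` is the first edge of an alternating ear. -/
lemma Rigid.exists_ear_of_true [Finite V] (hr : Rigid G μ) {c : G.Coloring Bool}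
    {K : G.Subgraph} (hK : Good μ c K) {x y : V} (hx : x ∈ K.verts) (hcx : c x = true)
    (hxy : (nonFixedSubgraph G).Adj x y) (hxyK : ¬ K.Adj x y) :
    ∃ P : G.Walk x (μ x), IsAltEar μ K P ∧ Good μ c (K ⊔ P.toSubgraph) := by
  have hμ := hr.1
  obtain ⟨n, -, hn⟩ := exists_rank (Step μ (nonFixedSubgraph G)) K.verts
  have hyx : y ≠ μ x := fun e => hxyK (e ▸ hK.closed x hx)
  have hcy : c y = false := by
    have := c.valid hxy.1
    rw [hcx] at this
    simpa using this.symm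
  have hstep0 : Step μ (nonFixedSubgraph G) x (μ y) :=
    ⟨by rwa [hμ.invol], fun e => hyx (hμ.eq_comm.1 e.symm)⟩
  -- If `y` were in `K`, the single edge `xy` would be a complete excursion returning at `z = y`.
  have hyK : y ∉ K.verts := fun hy => hyx <|
    hr.exit_eq hK n hx hy hcx hxy.1 hxyK (fun _ => rfl) (.single hstep0)
      (fun _ _ => Reachable.refl _)
  have huK : μ y ∉ K.verts := fun h => hyK (by
    have := (hK.closed _ h).snd_mem; rwa [hμ.invol] at this)
  have hcu : c (μ y) = true := by
    have := c.valid (hμ.adj y)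
    rw [hcy] at this
    simpa using this.symm
  obtain ⟨z, hz, W, h1, h2, h3, h4, h5, h6, h7, h8, h9, h10⟩ :=
    exists_exit_walk hμ c hK.closed n hn _ (μ y) rfl huK hcu ⟨x, hx, reach_nonFixedSubgraph hμ hxy⟩
  have hWnf : W.toSubgraph ≤ nonFixedSubgraph G := by
    refine ⟨fun q hq => ?_, fun a b hab => (h7 a b hab).1⟩
    rw [Walk.mem_verts_toSubgraph] at hq
    by_cases hnil : W.Nil
    · exact absurd (hnil.eq ▸ hz) huK
    · rw [Walk.mem_support_iff_exists_mem_edges_of_not_nil hnil] at hq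
      obtain ⟨e, he, hqe⟩ := hq
      induction e with | h a b
      have := (h7 a b (Walk.adj_toSubgraph_iff_mem_edges.2 he)).1
      rcases Sym2.mem_iff.1 hqe with rfl | rfl
      · exact this.fst_mem
      · exact this.snd_mem
  obtain rfl : z = μ x := by
    refine hr.exit_eq hK n hx hz hcx hxy.1 hxyK (fun h => absurd h hyK)
      (.head hstep0 (reach_mono hWnf h8)) fun H hH => ?_
    exact (hH.matching y hyK).reachable.trans (h10 H hH)
  rw [hμ.invol] at h8 h9
  rw [hμ.invol] at h5
  have hnfy : (nonFixedSubgraph G).Adj y (μ y) := nonFixedSubgraph_adj_of_mem hμ hxy.snd_mem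
  have hxW : x ∉ W.support := fun h => hμ.ne x (h3 x h hx).symm
  set P : G.Walk x (μ x) := Walk.cons hxy.1 (Walk.cons (hμ.adj y) W) with hP
  have hsup : ∀ p, p ∈ P.support ↔ p = x ∨ p = y ∨ p ∈ W.support := by
    intro p; simp [hP]
  have hedge : ∀ e, e ∈ P.edges ↔ e = s(x, y) ∨ e = s(y, μ y) ∨ e ∈ W.edges := by
    intro e; simp [hP]
  have hWP : W.toSubgraph ≤ P.toSubgraph := by
    rw [hP]
    simp only [Walk.toSubgraph]
    exact le_sup_right.trans le_sup_right
  have hPadj : ∀ a b, P.toSubgraph.Adj a b → (nonFixedSubgraph G).Adj a b ∧ ¬ K.Adj a b := by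
    intro a b hab
    rw [Walk.adj_toSubgraph_iff_mem_edges, hedge, Sym2.eq_iff, Sym2.eq_iff] at hab
    rcases hab with (⟨rfl, rfl⟩ | ⟨rfl, rfl⟩) | (⟨rfl, rfl⟩ | ⟨rfl, rfl⟩) | hab
    · exact ⟨hxy, hxyK⟩
    · exact ⟨hxy.symm, fun h => hxyK h.symm⟩
    · exact ⟨hnfy, fun h => hyK h.fst_mem⟩
    · exact ⟨hnfy.symm, fun h => hyK h.snd_mem⟩
    · exact h7 a b (Walk.adj_toSubgraph_iff_mem_edges.2 hab)
  have hmatched : ∀ q ∈ P.support, q ∉ K.verts → s(q, μ q) ∈ P.edges := by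
    intro q hq hqK
    rw [hedge]
    rcases (hsup q).1 hq with rfl | rfl | hq
    · exact absurd hx hqK
    · exact Or.inr (Or.inl rfl)
    · by_cases hqu : q = μ y
      · rw [hqu, hμ.invol]; exact Or.inr (Or.inl Sym2.eq_swap)
      · exact Or.inr (Or.inr (h4 q hq hqK hqu))
  refine ⟨P, ⟨?_, ?_, hx, ?_, hmatched, hPadj⟩, ?_, ?_⟩
  · rw [hP, Walk.cons_isPath_iff, Walk.cons_isPath_iff, Walk.support_cons, List.mem_cons, not_or]
    exact ⟨⟨h1, h5⟩, hxy.1.ne, hxW⟩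
  · simp only [hP, Walk.length_cons]
    grind
  · intro q hq hqK
    rcases (hsup q).1 hq with rfl | rfl | hq
    · exact Or.inl rfl
    · exact absurd hqK hyK
    · exact Or.inr (h3 q hq hqK)
  · intro v hv
    by_cases hvK : v ∈ K.verts
    · exact Or.inl (hK.closed v hvK)
    · rcases hv with hv | hv
      · exact absurd hv hvK
      · rw [Walk.mem_verts_toSubgraph] at hv
        exact Or.inr (Walk.adj_toSubgraph_iff_mem_edges.2 (hmatched v hv hvK))
  · have hPnf : P.toSubgraph ≤ nonFixedSubgraph G := by
      refine ⟨fun q hq => ?_, fun a b hab => (hPadj a b hab).1⟩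
      rw [Walk.mem_verts_toSubgraph, hsup] at hq
      rcases hq with rfl | rfl | hq
      · exact hxy.fst_mem
      · exact hxy.snd_mem
      · exact hWnf.1 (by rwa [Walk.mem_verts_toSubgraph])
    have hPK : P.toSubgraph ≤ K ⊔ P.toSubgraph := le_sup_right
    have hstep : Step μ P.toSubgraph x (μ y) :=
      ⟨by rw [Walk.adj_toSubgraph_iff_mem_edges, hedge, hμ.invol]; exact Or.inl rfl, hstep0.2⟩
    -- Every first-class vertex on the ear reaches `x` and is reached from it, so alternating
    -- connectivity of the union reduces to that of `K`.
    have key : ∀ b ∈ (K ⊔ P.toSubgraph).verts, c b = true → ∃ r ∈ K.verts, c r = true ∧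
        ReflTransGen (Step μ (K ⊔ P.toSubgraph)) b r ∧
        ReflTransGen (Step μ (K ⊔ P.toSubgraph)) r b ∧
        ReflTransGen (Step μ (nonFixedSubgraph G)) b r := by
      intro b hb hcb
      by_cases hbK : b ∈ K.verts
      · exact ⟨b, hbK, hcb, .refl, .refl, .refl⟩
      · rcases hb with hb | hb
        · exact absurd hb hbK
        · rw [Walk.mem_verts_toSubgraph, hsup] at hb
          rcases hb with rfl | rfl | hb
          · exact absurd hx hbK
          · rw [hcy] at hcb; exact absurd hcb Bool.false_ne_true
          · obtain ⟨i1, i2⟩ := h9 b hb hbK hcb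
            have j2 := reach_mono hWP i2
            exact ⟨x, hx, hcx, reach_mono hPK j2,
              reach_mono hPK (.head hstep (reach_mono hWP i1)), reach_mono hPnf j2⟩
    intro a ha b hb hca hab
    have hcb : c b = true := by rw [← reach_color_eq hμ c hab, hca]
    obtain ⟨r, hr1, hr2, hr3, hr4, hr5⟩ := key a ha hca
    obtain ⟨r', hr1', hr2', hr3', hr4', hr5'⟩ := key b hb hcb
    refine hr3.trans (.trans ?_ hr4')
    exact reach_mono le_sup_left (hK.reach r hr1 r' hr1' hr2
      ((reach_nonFixedSubgraph_symm hμ hr5).trans (hab.trans hr5')))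

lemma swapColoring_swapColoring (c : G.Coloring Bool) : swapColoring (swapColoring c) = c := by
  ext v
  simp [swapColoring_apply]

lemma Rigid.exists_ear [Finite V] (hr : Rigid G μ) {c : G.Coloring Bool}
    {K : G.Subgraph} (hK : Good μ c K) {x y : V} (hx : x ∈ K.verts)
    (hxy : (nonFixedSubgraph G).Adj x y) (hxyK : ¬ K.Adj x y) :
    ∃ P : G.Walk x (μ x), IsAltEar μ K P ∧ Good μ c (K ⊔ P.toSubgraph) := by
  by_cases hcx : c x = true
  · exact hr.exists_ear_of_true hK hx hcx hxy hxyK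
  · obtain ⟨P, hP, hg⟩ := hr.exists_ear_of_true (hK.swap hr.1) hx
      (by rw [swapColoring_apply]; simpa using hcx) hxy hxyK
    have := hg.swap hr.1
    rw [swapColoring_swapColoring] at this
    exact ⟨P, hP, this⟩

end AntiForcing

/-! ### Assembling special ear decompositions -/

namespace AntiForcing

variable {V : Type*} {G : SimpleGraph V} {μ : V → V}

/-- `K` arises from a matching edge by adding `n` alternating ears. -/
inductive EarSeq (μ : V → V) : G.Subgraph → ℕ → Prop
  | base {x : V} (h : G.Adj x (μ x)) : EarSeq μ (G.subgraphOfAdj h) 0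
  | step {K : G.Subgraph} {n : ℕ} {x : V} {P : G.Walk x (μ x)} (hK : EarSeq μ K n)
      (hP : IsAltEar μ K P) : EarSeq μ (K ⊔ P.toSubgraph) (n + 1)

lemma IsAltEar.closed_sup {K : G.Subgraph} {x : V} {P : G.Walk x (μ x)} (hP : IsAltEar μ K P)
    (hK : ∀ v ∈ K.verts, K.Adj v (μ v)) :
    ∀ v ∈ (K ⊔ P.toSubgraph).verts, (K ⊔ P.toSubgraph).Adj v (μ v) := by
  intro v hv
  by_cases hvK : v ∈ K.verts
  · exact Or.inl (hK v hvK)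
  · rcases hv with hv | hv
    · exact absurd hv hvK
    · rw [Walk.mem_verts_toSubgraph] at hv
      exact Or.inr (Walk.adj_toSubgraph_iff_mem_edges.2 (hP.matched v hv hvK))

lemma closed_subgraphOfAdj (hμ : IsPM G μ) {x : V} (h : G.Adj x (μ x)) :
    ∀ v ∈ (G.subgraphOfAdj h).verts, (G.subgraphOfAdj h).Adj v (μ v) := by
  rintro v (rfl | rfl)
  · simp
  · rw [hμ.invol]; exact (subgraphOfAdj_adj_self h).symm

lemma EarSeq.closed (hμ : IsPM G μ) {K : G.Subgraph} {n : ℕ} (h : EarSeq μ K n) :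
    ∀ v ∈ K.verts, K.Adj v (μ v) := by
  induction h with
  | base h => exact closed_subgraphOfAdj hμ h
  | step _ hP ih => exact hP.closed_sup ih

lemma IsAltEar.connected_sup {K : G.Subgraph} {x : V} {P : G.Walk x (μ x)}
    (hP : IsAltEar μ K P) (hK : K.Connected) : (K ⊔ P.toSubgraph).Connected :=
  Subgraph.connected_sup hK.preconnected P.toSubgraph_connected.preconnected
    ⟨x, hP.mem, P.start_mem_verts_toSubgraph⟩

lemma IsAltEar.isEar (hμ : IsPM G μ) {K : G.Subgraph} {x : V} {P : G.Walk x (μ x)}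
    (hP : IsAltEar μ K P) (hK : ∀ v ∈ K.verts, K.Adj v (μ v)) : IsEar K P where
  isPath := hP.isPath
  odd_length := hP.odd_length
  left_mem := hP.mem
  right_mem := (hK x hP.mem).snd_mem
  color_ne c := c.valid (hμ.adj x)
  inner_disjoint := hP.inner
  edge_disjoint e he heK := by
    induction e with | h a b
    exact (hP.nonFixed a b (Walk.adj_toSubgraph_iff_mem_edges.2 he)).2 heK

lemma ncard_list_of_nodup {α : Type*} {l : List α} (h : l.Nodup) :
    {a | a ∈ l}.ncard = l.length := by
  classical
  rw [← List.toFinset_card_of_nodup h, ← Set.ncard_coe_finset]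
  congr
  ext a
  simp

/-- An ear of length `ℓ` adds `ℓ` edges and `ℓ - 1` vertices. So the number of ears is the
cyclomatic number of the connected graph `K`. -/
lemma EarSeq.card [Finite V] (hμ : IsPM G μ) {K : G.Subgraph} {n : ℕ} (h : EarSeq μ K n) :
    K.edgeSet.ncard + 1 = K.verts.ncard + n := by
  induction h with
  | base h =>
    rw [edgeSet_subgraphOfAdj, subgraphOfAdj_verts, Set.ncard_singleton, Set.ncard_pair h.ne]
  | @step K n x P hK hP ih =>
    have hcl := hK.closed hμ
    have e1 : (K ⊔ P.toSubgraph).edgeSet.ncard = K.edgeSet.ncard + P.length := by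
      rw [Subgraph.edgeSet_sup, Set.ncard_union_eq, ← P.length_edges,
        ← ncard_list_of_nodup hP.isPath.isTrail.edges_nodup]
      · congr
        ext e
        exact Walk.mem_edges_toSubgraph P
      · rw [Set.disjoint_left]
        intro e he he'
        exact (hP.isEar hμ hcl).edge_disjoint e ((Walk.mem_edges_toSubgraph P).1 he') he
    have e2 : (K ⊔ P.toSubgraph).verts.ncard + 2 = K.verts.ncard + (P.length + 1) := by
      have h1 := Set.ncard_union_add_ncard_inter K.verts P.toSubgraph.verts
      have h2 : K.verts ∩ P.toSubgraph.verts = {x, μ x} := by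
        ext q
        simp only [Set.mem_inter_iff, Walk.mem_verts_toSubgraph, Set.mem_insert_iff,
          Set.mem_singleton_iff]
        constructor
        · exact fun h => hP.inner q h.2 h.1
        · rintro (rfl | rfl)
          · exact ⟨hP.mem, P.start_mem_support⟩
          · exact ⟨(hcl x hP.mem).snd_mem, P.end_mem_support⟩
      have h3 : P.toSubgraph.verts.ncard = P.length + 1 := by
        rw [Walk.verts_toSubgraph, ← P.length_support]
        exact ncard_list_of_nodup hP.isPath.support_nodup
      rw [h2, Set.ncard_pair (hμ.ne x).symm, h3] at h1
      exact h1
    omega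

lemma cyclomaticNumber_coe_of_connected {K : G.Subgraph} (hK : K.Connected) :
    cyclomaticNumber K.coe = (K.edgeSet.ncard : ℤ) - K.verts.ncard + 1 := by
  have h1 : Nat.card K.coe.edgeSet = K.edgeSet.ncard := by
    rw [← Subgraph.image_coe_edgeSet_coe,
      Set.ncard_image_of_injective _ (Sym2.map.injective Subtype.val_injective)]
    rfl
  have h2 : Nat.card K.coe.ConnectedComponent = 1 := by
    rw [Nat.card_eq_one_iff_unique]
    have := hK.coe
    exact ⟨this.preconnected.subsingleton_connectedComponent,
      ⟨K.coe.connectedComponentMk ⟨_, hK.nonempty.some_mem⟩⟩⟩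
  unfold cyclomaticNumber
  rw [h1, h2]
  rfl

/-- Unrolls the inductive construction into the indexed sequence that `BipartiteEarDecomposition`
asks for. -/
lemma EarSeq.exists_seq {K : G.Subgraph} {n : ℕ} (h : EarSeq μ K n) :
    ∃ s : ℕ → G.Subgraph, (∃ (x : V) (hx : G.Adj x (μ x)), s 0 = G.subgraphOfAdj hx) ∧ s n = K ∧
      (∀ i ≤ n, EarSeq μ (s i) i) ∧
      ∀ i < n, ∃ (x : V) (P : G.Walk x (μ x)), IsAltEar μ (s i) P ∧
        s (i + 1) = s i ⊔ P.toSubgraph := by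
  induction h with
  | base h =>
    refine ⟨fun _ => G.subgraphOfAdj h, ⟨_, h, rfl⟩, rfl, fun i hi => ?_, fun i hi => ?_⟩
    · obtain rfl : i = 0 := by omega
      exact .base h
    · omega
  | @step K n x P hK hP ih =>
    obtain ⟨s, h0, h1, h2, h3⟩ := ih
    refine ⟨fun i => if i ≤ n then s i else K ⊔ P.toSubgraph, by simpa using h0, by simp,
      fun i hi => ?_, fun i hi => ?_⟩
    · by_cases hin : i ≤ n
      · simpa [hin] using h2 i hin
      · obtain rfl : i = n + 1 := by omega
        simpa using hK.step hP
    · rcases Nat.lt_succ_iff_lt_or_eq.1 hi with hin | rfl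
      · simpa [hin.le, Nat.succ_le_of_lt hin] using h3 i hin
      · exact ⟨x, P, by simpa [h1] using hP, by simp [h1]⟩

lemma isPerfectMatchingOf_inf (hμ : IsPM G μ) {K : G.Subgraph}
    (hK : ∀ v ∈ K.verts, K.Adj v (μ v)) : IsPerfectMatchingOf (hμ.toSubgraph ⊓ K) K :=
  ⟨inf_le_right, fun v hv => ⟨μ v, ⟨rfl, hK v hv.2⟩, fun _ hw => hw.1⟩, Set.univ_inter _⟩

lemma EarSeq.hasSpecialEarDecomposition [Finite V] (hμ : IsPM G μ) {K : G.Subgraph} {n : ℕ}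
    (h : EarSeq μ K n) (hc : K.Connected) (hn : 1 ≤ n) : HasSpecialEarDecomposition K := by
  obtain ⟨s, ⟨x, hx, h0⟩, h1, h2, h3⟩ := h.exists_seq
  have hmono : ∀ j, ∀ i ≤ j, j ≤ n → s i ≤ s j := by
    intro j
    induction j with
    | zero => intro i hi _; rw [Nat.le_zero.1 hi]
    | succ j ih =>
      intro i hi hj
      rcases Nat.le_succ_iff.1 hi with hi | rfl
      · obtain ⟨x, P, -, e⟩ := h3 j hj
        rw [e]
        exact (ih i hi (by omega)).trans le_sup_left
      · exact le_rfl
  choose u P hP hs using fun i : Fin n => h3 i i.2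
  have hle : ∀ i : Fin (n + 1), s i ≤ K := fun i => by
    rw [← h1]; exact hmono n i (Nat.lt_succ_iff.1 i.2) le_rfl
  have hcl : ∀ i : Fin (n + 1), ∀ v ∈ (s i).verts, (s i).Adj v (μ v) := fun i =>
    (h2 i (Nat.lt_succ_iff.1 i.2)).closed hμ
  let D : BipartiteEarDecomposition K :=
    { r := n
      graph := fun i => s i
      u := u
      v := fun i => μ (u i)
      ear := P
      graph_zero := ⟨x, μ x, hx, h0⟩
      isEar := fun i => (hP i).isEar hμ (hcl i.castSucc)
      graph_succ := fun i => hs i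
      graph_last := h1 }
  have hM : ∀ i : Fin (n + 1), hμ.toSubgraph ⊓ K ⊓ s i = hμ.toSubgraph ⊓ s i := fun i => by
    rw [inf_assoc, inf_eq_right.2 (hle i)]
  refine ⟨hμ.toSubgraph ⊓ K, D, isPerfectMatchingOf_inf hμ (h.closed hμ), ?_, hn,
    fun i => ?_, fun i => ?_⟩
  · rw [cyclomaticNumber_coe_of_connected hc]
    have := h.card hμ
    change (n : ℤ) = _
    omega
  · change IsPerfectMatchingOf (hμ.toSubgraph ⊓ K ⊓ s i) (s i)
    rw [hM]
    exact isPerfectMatchingOf_inf hμ (hcl i)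
  · change (hμ.toSubgraph ⊓ K ⊓ s i.castSucc).Adj (u i) (μ (u i))
    rw [hM]
    exact ⟨rfl, hcl i.castSucc _ (hP i).mem⟩

lemma good_subgraphOfAdj (hμ : IsPM G μ) (c : G.Coloring Bool) {x : V} (h : G.Adj x (μ x)) :
    Good μ c (G.subgraphOfAdj h) := by
  refine ⟨closed_subgraphOfAdj hμ h, fun a ha b hb _ hab => ?_⟩
  have e1 := reach_color_eq hμ c hab
  have e2 := c.valid h
  rcases ha with rfl | rfl <;> rcases hb with rfl | rfl
  · exact .refl
  · exact absurd e1 e2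
  · exact absurd e1.symm e2
  · exact .refl

lemma subgraph_le_of_closed {K N : G.Subgraph} (hN : N.Connected) {x : V} (hxK : x ∈ K.verts)
    (hxN : x ∈ N.verts) (h : ∀ a b, a ∈ K.verts → N.Adj a b → K.Adj a b) : N ≤ K := by
  have hverts : N.verts ⊆ K.verts := by
    intro v hv
    obtain ⟨p⟩ := (subgraph_connected_iff.1 hN).2 x hxN v hv
    clear hxN hv
    induction p with
    | nil => exact hxK
    | cons hadj p ih => exact ih (h _ _ hxK hadj).snd_mem
  exact ⟨hverts, fun a b hab => h a b (hverts hab.fst_mem) hab⟩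

lemma IsAltEar.le_nonFixedSubgraph {K : G.Subgraph} {x : V} {P : G.Walk x (μ x)}
    (hP : IsAltEar μ K P) (hμ : IsPM G μ) : P.toSubgraph ≤ nonFixedSubgraph G := by
  have hnil : ¬ P.Nil := fun h => hμ.ne x h.eq.symm
  rw [Walk.toSubgraph_le_iff hnil]
  intro e he
  induction e with | h a b
  exact (hP.nonFixed a b (Walk.adj_toSubgraph_iff_mem_edges.2 he)).1

/-- Normal components of a rigid graph have special ear decompositions. -/
theorem Rigid.hasSpecialEarDecomposition [Finite V] (hr : Rigid G μ) {N : G.Subgraph}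
    (hN : IsNormalComponent N) : HasSpecialEarDecomposition N := by
  have hμ := hr.1
  obtain ⟨c⟩ := exists_boolColoring hr.isBipartite
  obtain ⟨x, hx⟩ := hN.1.2.nonempty
  have hnfx := nonFixedSubgraph_adj_of_mem hμ (hN.1.1.1 hx)
  have hbase : G.subgraphOfAdj (hμ.adj x) ≤ nonFixedSubgraph G :=
    (subgraphOfAdj_le_iff _ _).2 hnfx
  obtain ⟨K, hbK, ⟨hKnf, hKc, hKg, n, hKn⟩, hmax⟩ := (Set.toFinite
    {K : G.Subgraph | K ≤ nonFixedSubgraph G ∧ K.Connected ∧ Good μ c K ∧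
      ∃ n, EarSeq μ K n}).exists_le_maximal
    (show G.subgraphOfAdj (hμ.adj x) ∈ _ from ⟨hbase, Subgraph.subgraphOfAdj_connected _,
      good_subgraphOfAdj hμ c _, 0, .base _⟩)
  have hclosed : ∀ a b, a ∈ K.verts → (nonFixedSubgraph G).Adj a b → K.Adj a b := by
    intro a b ha hab
    by_contra hn
    obtain ⟨P, hP, hg⟩ := hr.exists_ear hKg ha hab hn
    have hle := hmax ⟨sup_le hKnf (hP.le_nonFixedSubgraph hμ), hP.connected_sup hKc, hg, n + 1,
      hKn.step hP⟩ le_sup_left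
    have hnil : ¬ P.Nil := fun h => hμ.ne a h.eq.symm
    have hadj := P.toSubgraph_adj_snd hnil
    exact (hP.nonFixed _ _ hadj).2 ((le_sup_right.trans hle).2 hadj)
  have hxK : x ∈ K.verts := hbK.1 (by simp)
  have hNK : N ≤ K := subgraph_le_of_closed hN.1.2 hxK hx fun a b ha hab =>
    hclosed a b ha (hN.1.1.2 hab)
  obtain rfl : N = K := le_antisymm hNK (hN.2 ⟨hKnf, hKc⟩ hNK)
  refine hKn.hasSpecialEarDecomposition hμ hKc ?_
  rw [Nat.one_le_iff_ne_zero]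
  rintro rfl
  -- Without ears `N` would be one matching edge; but that edge is non-fixed, and the edge at `x` of
  -- a matching avoiding it belongs to `N` as well.
  obtain ⟨-, μ', h', hne⟩ := (not_isFixedEdge_iff hnfx.1).1 hnfx.2
  have hadj := hN.adj_of_mem hx (nonFixedSubgraph_adj_of_mem h' (hN.1.1.1 hx))
  cases hKn with
  | @base y h =>
    rw [subgraphOfAdj_adj, Sym2.eq_iff] at hadj
    rcases hadj with ⟨rfl, e⟩ | ⟨e, rfl⟩
    · exact hne e.symm
    · exact hne (by rw [← e, hμ.invol])

end AntiForcing

/-! ### Straight-line drawings -/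

namespace AntiForcing

section Geometry

open MeasureTheory Topology

/-- The Euclidean plane. -/
abbrev Plane : Type := EuclideanSpace ℝ (Fin 2)

lemma affineSpan_pair_ne_top (a b : Plane) : affineSpan ℝ {a, b} ≠ ⊤ := by
  intro h
  have h1 := (collinear_iff_finrank_le_one (k := ℝ)).1 (collinear_pair ℝ a b)
  rw [← direction_affineSpan, h, AffineSubspace.direction_top, finrank_top,
    finrank_euclideanSpace_fin] at h1
  omega

/-- Arbitrarily close to `m` there are points in general position. -/
lemma exists_general_position {ι : Type*} [Finite ι] (p : ι → Plane) {m : Plane} {P : Plane → Prop}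
    (hP : ∀ᶠ q in 𝓝 m, P q) :
    ∃ q, P q ∧ (∀ a, q ≠ p a) ∧ ∀ a b, q ∉ affineSpan ℝ {p a, p b} := by
  obtain ⟨U, hU, hUo, hm⟩ := eventually_nhds_iff.1 hP
  -- The finitely many lines through the given points form a null set, so they cannot cover a
  -- neighborhood of `m`.
  have h0 : volume (⋃ ab : ι × ι, (affineSpan ℝ {p ab.1, p ab.2} : Set Plane)) = 0 :=
    measure_iUnion_null fun ab => Measure.addHaar_affineSubspace _ _ (affineSpan_pair_ne_top _ _)
  have h1 : 0 < volume U := hUo.measure_pos _ ⟨m, hm⟩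
  obtain ⟨q, hqU, hq⟩ : (U \ ⋃ ab : ι × ι, (affineSpan ℝ {p ab.1, p ab.2} : Set Plane)).Nonempty := by
    by_contra hne
    rw [Set.not_nonempty_iff_eq_empty, Set.sdiff_eq_empty] at hne
    exact (measure_mono hne).not_gt (by rwa [h0])
  have hq' : ∀ a b, q ∉ affineSpan ℝ {p a, p b} := fun a b h => hq (Set.mem_iUnion.2 ⟨(a, b), h⟩)
  exact ⟨q, hU q hqU, fun a h => hq' a a (h ▸ left_mem_affineSpan_pair _ _ _), hq'⟩

/-- By compactness of the parameter interval, a small move of one end keeps the segment off a closed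
set. -/
lemma eventually_disjoint_segment {x m : Plane} {K : Set Plane} (hK : IsClosed K)
    (h : Disjoint (segment ℝ x m) K) : ∀ᶠ q in 𝓝 m, Disjoint (segment ℝ x q) K := by
  have hc : Continuous fun z : Plane × ℝ => AffineMap.lineMap (k := ℝ) x z.1 z.2 := by
    simp only [AffineMap.lineMap_apply]
    fun_prop
  have := (isCompact_Icc (a := (0 : ℝ)) (b := 1)).eventually_forall_of_forall_eventually
    (x₀ := m) (P := fun q t => AffineMap.lineMap (k := ℝ) x q t ∉ K) (fun t ht => by
      have hmem : AffineMap.lineMap (k := ℝ) x m t ∉ K := fun hin =>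
        Set.disjoint_left.1 h (by rw [segment_eq_image_lineMap]; exact ⟨t, ht, rfl⟩) hin
      exact (hc.tendsto (m, t)).eventually (hK.isOpen_compl.mem_nhds hmem))
  filter_upwards [this] with q hq
  rw [Set.disjoint_left, segment_eq_image_lineMap]
  rintro _ ⟨t, ht, rfl⟩
  exact hq t ht

lemma mem_affineSpan_of_mem_segment {x q z : Plane} (hz : z ∈ segment ℝ x q) (hzx : z ≠ x) :
    q ∈ affineSpan ℝ {x, z} := by
  rw [segment_eq_image_lineMap] at hz
  obtain ⟨t, -, rfl⟩ := hz
  have ht : t ≠ 0 := by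
    rintro rfl
    simp at hzx
  have : q = AffineMap.lineMap (k := ℝ) x (AffineMap.lineMap (k := ℝ) x q t) t⁻¹ := by
    simp [AffineMap.lineMap_apply, smul_smul, inv_mul_cancel₀ ht]
  have h := AffineMap.lineMap_mem_affineSpan_pair (k := ℝ) t⁻¹ x (AffineMap.lineMap (k := ℝ) x q t)
  rwa [← this] at h

lemma mem_affineSpan_of_mem_segment' {a b z : Plane} (hz : z ∈ segment ℝ a b) :
    z ∈ affineSpan ℝ {a, b} := by
  rw [segment_eq_image_lineMap] at hz
  obtain ⟨t, -, rfl⟩ := hz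
  exact AffineMap.lineMap_mem_affineSpan_pair _ _ _

/-- Two segments with a common end meet only there unless they are collinear. -/
lemma eq_of_mem_segment_of_mem_segment {x b q z : Plane} (hq : q ∉ affineSpan ℝ {x, b})
    (h1 : z ∈ segment ℝ x b) (h2 : z ∈ segment ℝ x q) : z = x := by
  by_contra hne
  refine hq ?_
  have h3 := mem_affineSpan_of_mem_segment h2 hne
  exact affineSpan_pair_le_of_mem_of_mem (left_mem_affineSpan_pair ℝ x b)
    (mem_affineSpan_of_mem_segment' h1) h3

lemma eq_of_mem_segment_midpoint {a b : Plane} (h : b ∈ segment ℝ a (midpoint ℝ a b)) : a = b := by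
  have h1 := (convex_closedBall a (dist (midpoint ℝ a b) a)).segment_subset
    (Metric.mem_closedBall_self dist_nonneg) (Metric.mem_closedBall.2 le_rfl) h
  rw [Metric.mem_closedBall, dist_midpoint_left, dist_comm a b] at h1
  have h2 : dist b a ≤ 0 := by
    norm_num at h1
    linarith [dist_nonneg (x := b) (y := a)]
  exact (dist_le_zero.1 h2).symm

variable {V : Type*}

/-- A drawing of `H` in the plane with straight edges. -/
structure StraightDrawing (H : SimpleGraph V) (p : V → Plane) : Prop where
  inj : Function.Injective p
  vertex : ∀ a b w, H.Adj a b → p w ∈ segment ℝ (p a) (p b) → w = a ∨ w = b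
  cross : ∀ a b a' b', H.Adj a b → H.Adj a' b' → s(a, b) ≠ s(a', b') →
    ∀ q ∈ segment ℝ (p a) (p b), q ∈ segment ℝ (p a') (p b') →
      ∃ w, p w = q ∧ w ∈ s(a, b) ∧ w ∈ s(a', b')

/-- `H` has a drawing in the plane with straight edges. -/
def Drawable (H : SimpleGraph V) : Prop := ∃ p, StraightDrawing H p

lemma Drawable.mono {H K : SimpleGraph V} (h : Drawable K) (hle : H ≤ K) : Drawable H := by
  obtain ⟨p, h1, h2, h3⟩ := h
  exact ⟨p, h1, fun a b w hab => h2 a b w (hle hab), fun a b a' b' hab hab' =>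
    h3 a b a' b' (hle hab) (hle hab')⟩

lemma drawable_bot [Finite V] : Drawable (⊥ : SimpleGraph V) := by
  obtain ⟨n, ⟨e⟩⟩ := Finite.exists_equiv_fin V
  have : Infinite Plane := inferInstance
  exact ⟨fun v => Infinite.natEmbedding Plane (e v), fun a b h => e.injective
    (Fin.ext ((Infinite.natEmbedding Plane).injective h)), fun _ _ _ h => h.elim,
    fun _ _ _ _ h => h.elim⟩

lemma Drawable.isPlanar {H : SimpleGraph V} (h : Drawable H) : IsPlanar H := by
  obtain ⟨p, h1, h2, h3⟩ := h
  refine ⟨⟨p, Sym2.lift ⟨fun a b => segment ℝ (p a) (p b), fun a b => segment_symm ℝ _ _⟩, h1,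
    fun u v huv => ?_, ?_, ?_⟩⟩
  · refine ⟨⟨⟨fun t => AffineMap.lineMap (p u) (p v) (t : ℝ), ?_⟩, by simp, by simp⟩, ?_, ?_⟩
    · simp only [AffineMap.lineMap_apply]
      fun_prop
    · intro s t hst
      exact Subtype.ext (AffineMap.lineMap_injective ℝ (h1.ne huv.ne) hst)
    · simp only [Sym2.lift_mk, segment_eq_image_lineMap]
      ext z
      constructor
      · rintro ⟨t, rfl⟩
        exact ⟨t, t.2, rfl⟩
      · rintro ⟨t, ht, rfl⟩
        exact ⟨⟨t, ht⟩, rfl⟩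
  · intro e he w hw
    induction e with | h a b
    rw [Sym2.mem_iff]
    exact h2 a b w he hw
  · intro e he f hf hef q hq
    induction e with | h a b
    induction f with | h a' b'
    obtain ⟨w, hw, hw'⟩ := h3 a b a' b' he hf hef q hq.1 hq.2
    exact ⟨w, hw', hw⟩

/-- Drawing an isolated vertex `w` next to the edge `uv` (or next to `u`, if `u = v`). -/
lemma Drawable.sup_edge_sup_edge [Finite V] {H : SimpleGraph V} (h : Drawable H) {u v w : V}
    (hw : ∀ a, ¬ H.Adj w a) (hwu : w ≠ u) (hwv : w ≠ v) (huv : u = v ∨ H.Adj u v) :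
    Drawable (H ⊔ edge w u ⊔ edge w v) := by
  classical
  obtain ⟨p, h1, h2, h3⟩ := h
  -- The new vertex goes to a generic point near the midpoint of `uv`. The half-edges to the
  -- midpoint miss every edge not at their outer end, an open condition that the new segments
  -- inherit; genericity excludes overlaps with the edges at that end.
  set m := midpoint ℝ (p u) (p v) with hm
  have hdisj : ∀ x, (x = u ∨ x = v) → ∀ a b, H.Adj a b → x ≠ a → x ≠ b →
      Disjoint (segment ℝ (p x) m) (segment ℝ (p a) (p b)) := by
    have key : ∀ x y, (x = y ∨ H.Adj x y) → m = midpoint ℝ (p x) (p y) → ∀ a b, H.Adj a b →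
        x ≠ a → x ≠ b → Disjoint (segment ℝ (p x) m) (segment ℝ (p a) (p b)) := by
      intro x y hxy hmxy a b hab hxa hxb
      rw [Set.disjoint_left]
      intro z hz hz'
      rcases hxy with rfl | hxy
      · rw [hmxy, midpoint_self, segment_same, Set.mem_singleton_iff] at hz
        rw [hz] at hz'
        rcases h2 a b x hab hz' with e | e
        · exact hxa e
        · exact hxb e
      · have hmem : m ∈ segment ℝ (p x) (p y) := by rw [hmxy]; exact midpoint_mem_segment _ _
        have hz2 := (convex_segment (p x) (p y)).segment_subset (left_mem_segment ℝ _ _) hmem hz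
        obtain ⟨w', rfl, e1, e2⟩ := h3 x y a b hxy hab (fun e => by
          rcases Sym2.eq_iff.1 e with ⟨e, -⟩ | ⟨e, -⟩
          · exact hxa e
          · exact hxb e) z hz2 hz'
        rw [Sym2.mem_iff] at e1 e2
        rcases e1 with rfl | rfl
        · rcases e2 with e | e
          · exact hxa e
          · exact hxb e
        · rw [hmxy] at hz
          exact h1.ne hxy.ne (eq_of_mem_segment_midpoint hz)
    rintro x (rfl | rfl)
    · exact key x v huv hm
    · exact key x u (huv.imp Eq.symm Adj.symm) (by rw [hm, midpoint_comm])
  have hev : ∀ᶠ q in 𝓝 m, ∀ x, (x = u ∨ x = v) → ∀ a b, H.Adj a b → x ≠ a → x ≠ b →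
      Disjoint (segment ℝ (p x) q) (segment ℝ (p a) (p b)) := by
    simp only [Filter.eventually_all]
    intro x hx a b hab hxa hxb
    exact eventually_disjoint_segment (by
      rw [segment_eq_image_lineMap]
      exact (isCompact_Icc.image AffineMap.lineMap_continuous).isClosed) (hdisj x hx a b hab hxa hxb)
  obtain ⟨q, hq1, hq2, hq3⟩ := exists_general_position p hev
  have hpw : Function.update p w q w = q := Function.update_self ..
  have hpn : ∀ a, a ≠ w → Function.update p w q a = p a := fun a ha =>
    Function.update_of_ne ha ..
  have hcases : ∀ a b, (H ⊔ edge w u ⊔ edge w v).Adj a b →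
      (H.Adj a b ∧ segment ℝ (Function.update p w q a) (Function.update p w q b) =
        segment ℝ (p a) (p b)) ∨
      ∃ x, (x = u ∨ x = v) ∧ s(a, b) = s(w, x) ∧
        segment ℝ (Function.update p w q a) (Function.update p w q b) = segment ℝ (p x) q := by
    have hnew : ∀ x, x ≠ w → ∀ a b, s(a, b) = s(w, x) →
        segment ℝ (Function.update p w q a) (Function.update p w q b) = segment ℝ (p x) q := by
      intro x hx a b hab
      rcases Sym2.eq_iff.1 hab with ⟨rfl, rfl⟩ | ⟨rfl, rfl⟩
      · rw [hpw, hpn _ hx, segment_symm]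
      · rw [hpw, hpn _ hx]
    rintro a b ((hab | hab) | hab)
    · refine Or.inl ⟨hab, ?_⟩
      rw [hpn a (fun e => hw b (e ▸ hab)), hpn b (fun e => hw a (e ▸ hab.symm))]
    · rw [edge_adj] at hab
      have : s(a, b) = s(w, u) := by rw [Sym2.eq_iff]; tauto
      exact Or.inr ⟨u, Or.inl rfl, this, hnew u hwu.symm a b this⟩
    · rw [edge_adj] at hab
      have : s(a, b) = s(w, v) := by rw [Sym2.eq_iff]; tauto
      exact Or.inr ⟨v, Or.inr rfl, this, hnew v hwv.symm a b this⟩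
  have hxw : ∀ x, (x = u ∨ x = v) → x ≠ w := by
    rintro x (rfl | rfl)
    · exact hwu.symm
    · exact hwv.symm
  have hmix : ∀ a b x z, H.Adj a b → (x = u ∨ x = v) → z ∈ segment ℝ (p a) (p b) →
      z ∈ segment ℝ (p x) q → z = p x ∧ x ∈ s(a, b) := by
    intro a b x z hab hx hz hz'
    by_cases hxa : x = a
    · subst hxa
      exact ⟨eq_of_mem_segment_of_mem_segment (hq3 _ _) hz hz', Sym2.mem_mk_left _ _⟩
    · by_cases hxb : x = b
      · subst hxb
        rw [segment_symm] at hz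
        exact ⟨eq_of_mem_segment_of_mem_segment (hq3 _ _) hz hz', Sym2.mem_mk_right _ _⟩
      · exact absurd hz (Set.disjoint_left.1 (hq1 x hx a b hab hxa hxb) hz')
  refine ⟨Function.update p w q, ?_, ?_, ?_⟩
  · intro a b hab
    by_cases ha : a = w <;> by_cases hb : b = w
    · rw [ha, hb]
    · subst ha
      rw [hpw, hpn b hb] at hab
      exact absurd hab (hq2 b)
    · subst hb
      rw [hpw, hpn a ha] at hab
      exact absurd hab.symm (hq2 a)
    · rw [hpn a ha, hpn b hb] at hab
      exact h1 hab
  · intro a b y hab hy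
    rcases hcases a b hab with ⟨hab, hs⟩ | ⟨x, hx, hab, hs⟩
    · rw [hs] at hy
      by_cases hyw : y = w
      · rw [hyw, hpw] at hy
        exact absurd (mem_affineSpan_of_mem_segment' hy) (hq3 _ _)
      · rw [hpn y hyw] at hy
        exact h2 a b y hab hy
    · rw [hs] at hy
      have : y ∈ s(a, b) := by
        rw [hab, Sym2.mem_iff]
        by_contra! hcon
        rw [hpn y hcon.1] at hy
        exact hq3 _ _ (mem_affineSpan_of_mem_segment hy (h1.ne hcon.2))
      exact Sym2.mem_iff.1 this
  · intro a b a' b' hab hab' hne z hz hz'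
    rcases hcases a b hab with ⟨hold, hs⟩ | ⟨x, hx, hab, hs⟩ <;>
      rcases hcases a' b' hab' with ⟨hold', hs'⟩ | ⟨x', hx', hab', hs'⟩ <;>
      rw [hs] at hz <;> rw [hs'] at hz'
    · obtain ⟨y, e, i1, i2⟩ := h3 a b a' b' hold hold' hne z hz hz'
      refine ⟨y, ?_, i1, i2⟩
      rw [hpn y, e]
      rintro rfl
      rcases Sym2.mem_iff.1 i1 with rfl | rfl
      · exact hw _ hold
      · exact hw _ hold.symm
    · obtain ⟨rfl, e⟩ := hmix a b x' z hold hx' hz hz'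
      exact ⟨x', hpn _ (hxw _ hx'), e, by rw [hab']; exact Sym2.mem_mk_right _ _⟩
    · obtain ⟨rfl, e⟩ := hmix a' b' x z hold' hx hz' hz
      exact ⟨x, hpn _ (hxw _ hx), by rw [hab]; exact Sym2.mem_mk_right _ _, e⟩
    · refine ⟨w, ?_, by rw [hab]; exact Sym2.mem_mk_left _ _,
        by rw [hab']; exact Sym2.mem_mk_left _ _⟩
      rw [hpw]
      have hxx : x ≠ x' := by
        rintro rfl
        exact hne (hab.trans hab'.symm)
      by_contra hqz
      rw [segment_symm] at hz hz'
      -- A second common point of the two new segments would put `q` on the line through the two old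
      -- ends.
      have i1 := mem_affineSpan_of_mem_segment hz (Ne.symm hqz)
      have i2 := mem_affineSpan_of_mem_segment hz' (Ne.symm hqz)
      exact hq3 x x' ((collinear_insert_insert_of_mem_affineSpan_pair i1
        i2).mem_affineSpan_of_mem_of_ne (by simp) (by simp) (by simp) (h1.ne hxx))

lemma Drawable.sup_edge [Finite V] {H : SimpleGraph V} (h : Drawable H) {u w : V}
    (hw : ∀ a, ¬ H.Adj w a) (hwu : w ≠ u) : Drawable (H ⊔ edge w u) :=
  (h.sup_edge_sup_edge hw hwu hwu (Or.inl rfl)).mono le_sup_left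

/-- Drawing a path parallel to an edge. -/
lemma Drawable.sup_path [Finite V] {G : SimpleGraph V} {u v : V} (P : G.Walk u v) (hP : P.IsPath)
    {H : SimpleGraph V} (h : Drawable H) (huv : H.Adj u v)
    (hi : ∀ q ∈ P.support, q ≠ u → q ≠ v → ∀ a, ¬ H.Adj q a) :
    Drawable (H ⊔ P.toSubgraph.spanningCoe) := by
  induction P generalizing H with
  | nil => exact absurd rfl huv.ne
  | @cons u w v hadj P ih =>
    rw [Walk.cons_isPath_iff] at hP
    have hle : ∀ K : SimpleGraph V, H ≤ K → K.Adj u w → P.toSubgraph.spanningCoe ≤ K →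
        H ⊔ (Walk.cons hadj P).toSubgraph.spanningCoe ≤ K := by
      intro K h1 h2 h3
      refine sup_le h1 ?_
      intro a b hab
      rcases (hab : (Walk.cons hadj P).toSubgraph.Adj a b) with hab | hab
      · rw [subgraphOfAdj_adj, Sym2.eq_iff] at hab
        rcases hab with ⟨rfl, rfl⟩ | ⟨rfl, rfl⟩
        · exact h2
        · exact h2.symm
      · exact h3 hab
    by_cases hwv : w = v
    · subst hwv
      obtain rfl := (Walk.isPath_iff_nil.1 hP.1).eq_nil
      refine h.mono (hle H le_rfl huv ?_)
      intro a b hab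
      exact absurd hab (by simp)
    · have hwiso := hi w (by simp) hadj.ne' hwv
      -- Both `wu` and the auxiliary edge `wv` are drawn; the rest of the path then runs parallel to
      -- `wv`, and the extra edge is dropped at the end.
      have hd := h.sup_edge_sup_edge hwiso hadj.ne' hwv (Or.inr huv)
      refine (ih hP.1 hd (Or.inr ?_) ?_).mono (hle _ (le_sup_left.trans
        (le_sup_left.trans le_sup_left)) (Or.inl (Or.inl (Or.inr ?_))) le_sup_right)
      · rw [edge_adj]; exact ⟨Or.inl ⟨rfl, rfl⟩, hwv⟩
      · intro q hq hqw hqv a hqa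
        have hqu : q ≠ u := fun e => hP.2 (e ▸ hq)
        rcases hqa with (hqa | hqa) | hqa
        · exact hi q (by simp [hq]) hqu hqv a hqa
        · rw [edge_adj] at hqa; tauto
        · rw [edge_adj] at hqa; tauto
      · rw [edge_adj]; exact ⟨Or.inr ⟨rfl, rfl⟩, hadj.ne⟩

end Geometry

end AntiForcing

/-! ### Planarity of rigid graphs -/

namespace AntiForcing

variable {V : Type*} {G : SimpleGraph V} {μ : V → V}

/-- Adding a matching edge to a subgraph that is closed under non-fixed edges. -/
lemma Good.extend (hμ : IsPM G μ) {c : G.Coloring Bool} {K K' : G.Subgraph} (hK : Good μ c K)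
    (hcl : ∀ a b, a ∈ K.verts → (nonFixedSubgraph G).Adj a b → K.Adj a b) (hle : K ≤ K') {y : V}
    (hy : K'.Adj y (μ y)) (hv : ∀ v ∈ K'.verts, v ∈ K.verts ∨ v = y ∨ v = μ y) :
    Good μ c K' := by
  have hstep : ∀ a b, ReflTransGen (Step μ (nonFixedSubgraph G)) a b → a ∈ K.verts →
      b ∈ K.verts := by
    intro a b hab ha
    induction hab with
    | refl => exact ha
    | tail _ h ih =>
      have := (hK.closed _ (hcl _ _ ih h.1).snd_mem).snd_mem
      rwa [hμ.invol] at this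
  have hstep' : ∀ a b, ReflTransGen (Step μ (nonFixedSubgraph G)) a b → b ∈ K.verts →
      a ∈ K.verts := by
    intro a b hab hb
    have h1 := hstep _ _ (reach_flip hμ hab) (hK.closed b hb).snd_mem
    have := (hK.closed _ h1).snd_mem
    rwa [hμ.invol] at this
  refine ⟨fun v hv' => ?_, fun a ha b hb hca hab => ?_⟩
  · rcases hv v hv' with h | rfl | rfl
    · exact hle.2 (hK.closed v h)
    · exact hy
    · rw [hμ.invol]; exact hy.symm
  · by_cases haK : a ∈ K.verts
    · exact reach_mono hle (hK.reach a haK b (hstep a b hab haK) hca hab)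
    · have hbK : b ∉ K.verts := fun h => haK (hstep' a b hab h)
      have e1 := reach_color_eq hμ c hab
      have e2 := c.valid (hμ.adj y)
      rcases (hv a ha).resolve_left haK with rfl | rfl <;>
        rcases (hv b hb).resolve_left hbK with rfl | rfl
      · exact .refl
      · exact absurd e1 e2
      · exact absurd e1.symm e2
      · exact .refl

/-- `K` is a part of `G` that can be drawn and that preserves connectivity. -/
structure DrawablePart (μ : V → V) (c : G.Coloring Bool) (K : G.Subgraph) : Prop where
  good : Good μ c K
  drawable : Drawable K.spanningCoe
  reachable : ∀ a ∈ K.verts, ∀ b ∈ K.verts, G.Reachable a b → K.spanningCoe.Reachable a b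

lemma reachable_extend {K K' : G.Subgraph} (hle : K ≤ K')
    (hK : ∀ a ∈ K.verts, ∀ b ∈ K.verts, G.Reachable a b → K.spanningCoe.Reachable a b) {x : V}
    (hx : x ∈ K.verts)
    (hv : ∀ v ∈ K'.verts, v ∈ K.verts ∨ K'.spanningCoe.Reachable v x) :
    ∀ a ∈ K'.verts, ∀ b ∈ K'.verts, G.Reachable a b → K'.spanningCoe.Reachable a b := by
  have hG : K'.spanningCoe ≤ G := K'.spanningCoe_le
  have key : ∀ v ∈ K'.verts, ∃ r ∈ K.verts, K'.spanningCoe.Reachable v r := fun v hv' =>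
    (hv v hv').elim (fun h => ⟨v, h, .refl _⟩) fun h => ⟨x, hx, h⟩
  intro a ha b hb hab
  obtain ⟨r, hr, h1⟩ := key a ha
  obtain ⟨r', hr', h2⟩ := key b hb
  have h3 := hK r hr r' hr' (((h1.mono hG).symm.trans hab).trans (h2.mono hG))
  exact (h1.trans (h3.mono fun _ _ h => hle.2 h)).trans h2.symm

/-- A maximal drawable part is everything, because it can otherwise grow in one of three ways: by an
ear over one of its edges, by a pendant path `x, y, μ y` across a bridge, or by a matching edge in
an untouched component. -/
theorem Rigid.drawable [Finite V] (hr : Rigid G μ) : Drawable G := by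
  have hμ := hr.1
  obtain ⟨c⟩ := exists_boolColoring hr.isBipartite
  obtain ⟨K, -, hK, hmax⟩ := (Set.toFinite {K : G.Subgraph | DrawablePart μ c K}).exists_le_maximal
    (show (⊥ : G.Subgraph) ∈ _ from ⟨⟨fun v hv => hv.elim, fun a ha => ha.elim⟩,
      drawable_bot.mono fun a b h => h, fun a ha => ha.elim⟩)
  have hiso : ∀ {v}, v ∉ K.verts → ∀ a, ¬ K.spanningCoe.Adj v a := fun hv a h => hv h.fst_mem
  have hnf : ∀ a b, a ∈ K.verts → (nonFixedSubgraph G).Adj a b → K.Adj a b := by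
    intro x y hx hxy
    by_contra hn
    obtain ⟨P, hP, hg⟩ := hr.exists_ear hK.good hx hxy hn
    have hle := hmax (y := K ⊔ P.toSubgraph) ⟨hg, ?_, ?_⟩ le_sup_left
    · have hnil : ¬ P.Nil := fun h => hμ.ne x h.eq.symm
      have hadj := P.toSubgraph_adj_snd hnil
      exact (hP.nonFixed _ _ hadj).2 ((le_sup_right.trans hle).2 hadj)
    · refine (hK.drawable.sup_path P hP.isPath (hK.good.closed x hx) fun q hq hqx hqx' => ?_).mono
        (fun a b h => h)
      exact hiso fun h => (hP.inner q hq h).elim hqx hqx'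
    · refine reachable_extend le_sup_left hK.reachable hx fun v hv => ?_
      refine hv.imp id fun hv => ?_
      exact ((subgraph_connected_iff.1 P.toSubgraph_connected).2 v hv x
        P.start_mem_verts_toSubgraph).mono fun _ _ h => Or.inr h
  have hpartner : ∀ {v}, v ∉ K.verts → μ v ∉ K.verts := fun hv h => hv (by
    have := (hK.good.closed _ h).snd_mem; rwa [hμ.invol] at this)
  have hadj : ∀ x y, x ∈ K.verts → G.Adj x y → K.Adj x y := by
    intro x y hx hxy
    by_contra hn
    have hb : G.IsBridge s(x, y) := by
      by_contra hb
      exact hn (hnf x y hx (hr.nonFixedSubgraph_adj.2 ⟨hxy, hb⟩))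
    -- If `y` were already in `K`, it would be connected to `x` inside `K` without the bridge `xy`.
    have hy : y ∉ K.verts := fun hy => by
      refine isBridge_iff.1 hb ((hK.reachable x hx y hy hxy.reachable).mono ?_)
      intro a b hab
      rw [deleteEdges_adj]
      refine ⟨Subgraph.Adj.adj_sub hab, fun e => hn ?_⟩
      rw [← Subgraph.mem_edgeSet, ← (e : s(a, b) = s(x, y)), Subgraph.mem_edgeSet]
      exact hab
    have hμy := hpartner hy
    set K' := K ⊔ G.subgraphOfAdj hxy ⊔ G.subgraphOfAdj (hμ.adj y) with hK'
    have hKK' : K ≤ K' := le_sup_left.trans le_sup_left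
    have hyy : K'.Adj y (μ y) := Or.inr (subgraphOfAdj_adj_self _)
    have hxy' : K'.Adj x y := Or.inl (Or.inr (subgraphOfAdj_adj_self _))
    have hv : ∀ v ∈ K'.verts, v ∈ K.verts ∨ v = y ∨ v = μ y := by
      rintro v ((hv | hv) | hv)
      · exact Or.inl hv
      · rcases hv with rfl | rfl
        · exact Or.inl hx
        · exact Or.inr (Or.inl rfl)
      · exact Or.inr hv
    have hle := hmax (y := K') ⟨hK.good.extend hμ hnf hKK' hyy hv, ?_, ?_⟩ hKK'
    · exact hy (hle.1 hyy.fst_mem)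
    · have h1 := hK.drawable.sup_edge (hiso hy) hxy.ne'
      have h2 := h1.sup_edge (u := y) (w := μ y) (fun a ha => by
        rcases ha with ha | ha
        · exact hiso hμy a ha
        · rw [edge_adj] at ha
          rcases ha with ⟨⟨e, -⟩ | ⟨e, -⟩, -⟩
          · exact hμ.ne y e
          · exact hμy (e ▸ hx)) (hμ.ne y)
      refine h2.mono ?_
      rintro a b ((hab | hab) | hab)
      · exact Or.inl (Or.inl hab)
      · refine Or.inl (Or.inr ?_)
        rw [subgraphOfAdj_adj, Sym2.eq_iff] at hab
        rw [edge_adj]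
        rcases hab with ⟨rfl, rfl⟩ | ⟨rfl, rfl⟩
        · exact ⟨Or.inr ⟨rfl, rfl⟩, hxy.ne⟩
        · exact ⟨Or.inl ⟨rfl, rfl⟩, hxy.ne'⟩
      · refine Or.inr ?_
        rw [subgraphOfAdj_adj, Sym2.eq_iff] at hab
        rw [edge_adj]
        rcases hab with ⟨rfl, rfl⟩ | ⟨rfl, rfl⟩
        · exact ⟨Or.inr ⟨rfl, rfl⟩, (hμ.ne _).symm⟩
        · exact ⟨Or.inl ⟨rfl, rfl⟩, hμ.ne _⟩
    · refine reachable_extend hKK' hK.reachable hx fun v hv' => ?_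
      have h1 : K'.spanningCoe.Reachable y x := Adj.reachable (Subgraph.Adj.symm hxy')
      have h2 : K'.spanningCoe.Reachable (μ y) y := Adj.reachable (Subgraph.Adj.symm hyy)
      rcases hv v hv' with h | rfl | rfl
      · exact Or.inl h
      · exact Or.inr h1
      · exact Or.inr (h2.trans h1)
  have hreach : ∀ x y, G.Reachable x y → x ∈ K.verts → y ∈ K.verts := by
    rintro x y ⟨p⟩ hx
    induction p with
    | nil => exact hx
    | cons h p ih => exact ih (hadj _ _ hx h).snd_mem
  have huniv : ∀ v, v ∈ K.verts := by
    intro y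
    by_contra hy
    have hμy := hpartner hy
    set K' := K ⊔ G.subgraphOfAdj (hμ.adj y) with hK'
    have hKK' : K ≤ K' := le_sup_left
    have hyy : K'.Adj y (μ y) := Or.inr (subgraphOfAdj_adj_self _)
    have hv : ∀ v ∈ K'.verts, v ∈ K.verts ∨ v = y ∨ v = μ y := fun v hv => hv
    have hle := hmax (y := K') ⟨hK.good.extend hμ hnf hKK' hyy hv, ?_, ?_⟩ hKK'
    · exact hy (hle.1 hyy.fst_mem)
    · refine (hK.drawable.sup_edge (u := y) (w := μ y) (hiso hμy) (hμ.ne y)).mono ?_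
      rintro a b (hab | hab)
      · exact Or.inl hab
      · refine Or.inr ?_
        rw [subgraphOfAdj_adj, Sym2.eq_iff] at hab
        rw [edge_adj]
        rcases hab with ⟨rfl, rfl⟩ | ⟨rfl, rfl⟩
        · exact ⟨Or.inr ⟨rfl, rfl⟩, (hμ.ne _).symm⟩
        · exact ⟨Or.inl ⟨rfl, rfl⟩, hμ.ne _⟩
    · have hyy' : K'.spanningCoe.Reachable y (μ y) := Adj.reachable hyy
      have key : ∀ v ∈ K'.verts, v ∉ K.verts → K'.spanningCoe.Reachable v y := by
        intro v hv' hvK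
        rcases (hv v hv').resolve_left hvK with rfl | rfl
        · exact .refl _
        · exact hyy'.symm
      intro a ha b hb hab
      by_cases haK : a ∈ K.verts
      · exact (hK.reachable a haK b (hreach a b hab haK) hab).mono fun _ _ h => Or.inl h
      · have hbK : b ∉ K.verts := fun h => haK (hreach b a hab.symm h)
        exact (key a ha haK).trans (key b hb hbK).symm
  exact hK.drawable.mono fun a b h => hadj a b (huniv a) h

end AntiForcing

/-! ### From special ear decompositions back to rigidity -/

namespace AntiForcing

variable {V : Type*} {G : SimpleGraph V} {μ : V → V}

lemma reachable_deleteVerts_of_isPath {w v : V} (P : G.Walk w v) (hP : P.IsPath)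
    {K : G.Subgraph} (hK : ∀ a b, P.toSubgraph.Adj a b → K.Adj a b) :
    ∀ a ∈ P.support, a ≠ v → (K.deleteVerts {v}).spanningCoe.Reachable w a := by
  induction P with
  | nil =>
    intro a ha hav
    simp only [Walk.support_nil, List.mem_singleton] at ha
    exact absurd ha hav
  | @cons u w v h P ih =>
    intro a ha hav
    rw [Walk.cons_isPath_iff] at hP
    rw [Walk.support_cons, List.mem_cons] at ha
    rcases ha with rfl | ha
    · exact .refl _
    · have hwv : w ≠ v := by
        rintro rfl
        rw [(Walk.isPath_iff_nil.1 hP.1).eq_nil] at ha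
        simp only [Walk.support_nil, List.mem_singleton] at ha
        exact hav ha
      have huv : u ≠ v := fun e => hP.2 (e ▸ P.end_mem_support)
      have hadj : K.Adj u w := hK u w (Or.inl (subgraphOfAdj_adj_self h))
      refine (Adj.reachable ?_).trans (ih hP.1 (fun a b hab => hK a b (Or.inr hab)) a ha hav)
      rw [Subgraph.spanningCoe_adj, Subgraph.deleteVerts_adj]
      exact ⟨hadj.fst_mem, huv, hadj.snd_mem, hwv, hadj⟩

lemma isNonseparable_toSubgraph_of_isCycle {x : V} {C : G.Walk x x} (hC : C.IsCycle) :
    IsNonseparable C.toSubgraph := by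
  classical
  refine ⟨C.toSubgraph_connected, fun v hv => ?_⟩
  rw [Walk.mem_verts_toSubgraph] at hv
  -- Started at `v`, the cycle without its first edge is a path ending at `v`, and deleting that end
  -- keeps the rest connected.
  rw [← Walk.toSubgraph_rotate C hv, subgraph_preconnected_iff]
  have hC' := hC.rotate hv
  revert hC'
  generalize C.rotate v hv = C'
  intro hC'
  cases C' with
  | nil => exact absurd rfl hC'.ne_nil
  | @cons _ w _ h P =>
    rw [Walk.cons_isCycle_iff] at hC'
    have key := reachable_deleteVerts_of_isPath P hC'.1 (K := (Walk.cons h P).toSubgraph)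
      fun a b hab => Or.inr hab
    have hmem : ∀ a ∈ ((Walk.cons h P).toSubgraph.deleteVerts {v}).verts,
        a ∈ P.support ∧ a ≠ v := by
      rintro a ⟨ha, hav⟩
      rw [Walk.mem_verts_toSubgraph, Walk.support_cons, List.mem_cons] at ha
      exact ⟨ha.resolve_left hav, hav⟩
    intro a ha b hb
    exact (key a (hmem a ha).1 (hmem a ha).2).symm.trans (key b (hmem b hb).1 (hmem b hb).2)

lemma exists_two_adj_of_isCycle {H : SimpleGraph V} {x : V} {C : H.Walk x x} (hC : C.IsCycle)
    {y : V} (hy : y ∈ C.support) :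
    ∃ a b, a ≠ b ∧ C.toSubgraph.neighborSet y = {a, b} :=
  Set.ncard_eq_two.1 (hC.ncard_neighborSet_toSubgraph_eq_two hy)

/-- A single edge contains no cycle. -/
lemma not_isCycle_of_subset_subgraphOfAdj {H : SimpleGraph V} {x a b : V} (h : G.Adj a b)
    {C : H.Walk x x} (hC : C.IsCycle)
    (hsub : ∀ p q, C.toSubgraph.Adj p q → (G.subgraphOfAdj h).Adj p q) : False := by
  obtain ⟨p, q, hpq, hn⟩ := exists_two_adj_of_isCycle hC C.start_mem_support
  have h1 : C.toSubgraph.Adj x p := by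
    rw [← Subgraph.mem_neighborSet, hn]; simp
  have h2 : C.toSubgraph.Adj x q := by
    rw [← Subgraph.mem_neighborSet, hn]; simp
  have e1 := hsub _ _ h1
  have e2 := hsub _ _ h2
  rw [subgraphOfAdj_adj] at e1 e2
  exact hpq (Sym2.congr_right.1 (e1.symm.trans e2))

/-- Exchanging the matching along an ear. -/
lemma IsUniquePM.exists_edge_notMem {H : SimpleGraph V} (hH : IsUniquePM H μ) {K : G.Subgraph}
    (hK : ∀ v ∈ K.verts, K.Adj v (μ v)) {u : V} {P : G.Walk u (μ u)} (hP : IsEar K P)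
    (hKP : ∀ v ∈ (K ⊔ P.toSubgraph).verts, (K ⊔ P.toSubgraph).Adj v (μ v)) :
    ∃ k < P.length, ¬ H.Adj (P.getVert k) (P.getVert (k + 1)) := by
  classical
  by_contra! hcon
  have hμ := hH.1
  have hinj := hP.isPath.getVert_injOn
  have hL := hP.odd_length
  have hidx : ∀ q, ∃ j, q ∈ P.support → P.getVert j = q ∧ j ≤ P.length := by
    intro q
    by_cases hq : q ∈ P.support
    · obtain ⟨j, hj⟩ := Walk.mem_support_iff_exists_getVert.1 hq
      exact ⟨j, fun _ => hj⟩
    · exact ⟨0, fun h => absurd h hq⟩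
  choose idx hidx using hidx
  have hidx' : ∀ j ≤ P.length, idx (P.getVert j) = j := fun j hj => by
    obtain ⟨h1, h2⟩ := hidx _ (P.getVert_mem_support j)
    exact hinj h2 hj h1
  have hcl : ∀ q ∈ P.support, μ q ∈ P.support := by
    intro q hq
    by_cases hqK : q ∈ K.verts
    · rcases hP.inner_disjoint q hq hqK with rfl | rfl
      · exact P.end_mem_support
      · rw [hμ.invol]; exact P.start_mem_support
    · rcases hKP q (Or.inr ((Walk.mem_verts_toSubgraph P).2 hq)) with h | h
      · exact absurd h.fst_mem hqK
      · exact (Walk.mem_verts_toSubgraph P).1 h.snd_mem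
  have hcl' : ∀ q ∉ P.support, μ q ∉ P.support := fun q hq h => hq (by
    rw [← hμ.invol q]; exact hcl _ h)
  -- If `H` contained the whole ear, pairing its vertices at positions `0,1`, `2,3`, … would give a
  -- perfect matching of `H`; the odd length makes this exhaust the ear.
  let μ' : V → V := fun q => if q ∈ P.support then
    (if Even (idx q) then P.getVert (idx q + 1) else P.getVert (idx q - 1)) else μ q
  have he : ∀ j, j ≤ P.length → Even j → μ' (P.getVert j) = P.getVert (j + 1) := fun j hj hev => by
    simp only [μ', if_pos (P.getVert_mem_support j), hidx' j hj, if_pos hev]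
  have ho : ∀ j, j ≤ P.length → ¬ Even j → μ' (P.getVert j) = P.getVert (j - 1) :=
    fun j hj hev => by
    simp only [μ', if_pos (P.getVert_mem_support j), hidx' j hj, if_neg hev]
  have hn : ∀ q ∉ P.support, μ' q = μ q := fun q hq => if_neg hq
  have hcases : ∀ q, q ∉ P.support ∨ (∃ j < P.length, Even j ∧ q = P.getVert j) ∨
      ∃ j < P.length, Even j ∧ q = P.getVert (j + 1) := by
    intro q
    by_cases hq : q ∈ P.support
    · obtain ⟨h1, h2⟩ := hidx q hq
      by_cases hev : Even (idx q)
      · exact Or.inr (Or.inl ⟨idx q, lt_of_le_of_ne h2 fun e => Nat.not_even_iff_odd.2 hL (e ▸ hev), hev, h1.symm⟩)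
      · have hne : idx q ≠ 0 := fun e => hev (e ▸ Even.zero)
        exact Or.inr (Or.inr ⟨idx q - 1, by omega,
          Nat.Odd.sub_odd (Nat.not_even_iff_odd.1 hev) odd_one, by
          rw [Nat.sub_add_cancel (by omega), h1]⟩)
    · exact Or.inl hq
  have hpm : IsPM H μ' := by
    constructor
    · intro q
      rcases hcases q with hq | ⟨j, hj, hev, rfl⟩ | ⟨j, hj, hev, rfl⟩
      · rw [hn q hq]; exact hμ.adj q
      · rw [he j hj.le hev]; exact hcon j hj
      · rw [ho (j + 1) hj (fun h => Nat.even_add_one.1 h hev)]; exact (hcon j hj).symm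
    · intro q
      rcases hcases q with hq | ⟨j, hj, hev, rfl⟩ | ⟨j, hj, hev, rfl⟩
      · rw [hn q hq, hn _ (hcl' q hq), hμ.invol]
      · rw [he j hj.le hev, ho (j + 1) hj (fun h => Nat.even_add_one.1 h hev)]; rfl
      · rw [ho (j + 1) hj (fun h => Nat.even_add_one.1 h hev)]
        exact he j hj.le hev
  -- Uniqueness gives `μ' = μ`, so the first edge of the ear would be the matching edge at `u`,
  -- which already lies in `K`.
  have h0 := he 0 (Nat.zero_le _) (by simp)
  rw [hH.2 μ' hpm, Walk.getVert_zero, zero_add] at h0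
  have hpos : 0 < P.length := hL.pos
  have hadj := P.toSubgraph_adj_getVert hpos
  rw [Walk.getVert_zero, zero_add, ← h0, Walk.adj_toSubgraph_iff_mem_edges] at hadj
  exact hP.edge_disjoint _ hadj (hK u hP.left_mem)

/-- A cycle that misses an edge of an ear misses the whole ear. -/
lemma IsEar.adj_of_isCycle {K : G.Subgraph} {u v : V} {P : G.Walk u v} (hP : IsEar K P)
    {H : SimpleGraph V} {x : V} {C : H.Walk x x} (hC : C.IsCycle)
    (hsub : ∀ p q, C.toSubgraph.Adj p q → (K ⊔ P.toSubgraph).Adj p q) {k : ℕ} (hk : k < P.length)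
    (hkC : ¬ C.toSubgraph.Adj (P.getVert k) (P.getVert (k + 1))) :
    ∀ p q, C.toSubgraph.Adj p q → K.Adj p q := by
  have hinj := hP.isPath.getVert_injOn
  -- An inner vertex of the ear has only its two path neighbors in `K ⊔ P`, so a cycle uses both
  -- consecutive ear edges or neither.
  have hstep : ∀ j, j + 1 < P.length → (C.toSubgraph.Adj (P.getVert j) (P.getVert (j + 1)) ↔
      C.toSubgraph.Adj (P.getVert (j + 1)) (P.getVert (j + 2))) := by
    intro j hj
    have hnK : P.getVert (j + 1) ∉ K.verts := by
      intro h
      rcases hP.inner_disjoint _ (P.getVert_mem_support _) h with e | e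
      · have := hinj (show j + 1 ≤ P.length by omega) (Nat.zero_le P.length)
          (e.trans (P.getVert_zero).symm)
        omega
      · have := hinj (show j + 1 ≤ P.length by omega) (le_refl P.length)
          (e.trans (P.getVert_length).symm)
        omega
    have hnb : C.toSubgraph.neighborSet (P.getVert (j + 1)) ⊆
        {P.getVert j, P.getVert (j + 2)} := by
      intro w hw
      rcases hsub _ _ hw with h | h
      · exact absurd h.fst_mem hnK
      · have := hP.isPath.neighborSet_toSubgraph_internal (i := j + 1) (by omega) hj
        rw [← Subgraph.mem_neighborSet, this] at h
        exact h
    have main : ∀ w, C.toSubgraph.Adj (P.getVert (j + 1)) w →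
        C.toSubgraph.neighborSet (P.getVert (j + 1)) = {P.getVert j, P.getVert (j + 2)} := by
      intro w hw
      have h2 := hC.ncard_neighborSet_toSubgraph_eq_two
        ((Walk.mem_verts_toSubgraph C).1 hw.fst_mem)
      refine Set.eq_of_subset_of_ncard_le hnb ?_ (Set.toFinite _)
      rw [h2]
      exact Set.ncard_insert_le _ _ |>.trans (by rw [Set.ncard_singleton])
    constructor
    · intro h
      rw [← Subgraph.mem_neighborSet, main _ h.symm]
      simp
    · intro h
      refine Subgraph.Adj.symm ?_
      rw [← Subgraph.mem_neighborSet, main _ h]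
      simp
  have hall : ∀ j < P.length, (C.toSubgraph.Adj (P.getVert j) (P.getVert (j + 1)) ↔
      C.toSubgraph.Adj (P.getVert 0) (P.getVert 1)) := by
    intro j
    induction j with
    | zero => exact fun _ => Iff.rfl
    | succ j ih => exact fun hj => (hstep j hj).symm.trans (ih (by omega))
  intro p q hpq
  rcases hsub p q hpq with h | h
  · exact h
  · rw [Walk.toSubgraph_adj_iff] at h
    obtain ⟨j, hj, hjL⟩ := h
    exfalso
    refine hkC ((hall k hk).2 ((hall j hjL).1 ?_))
    rcases Sym2.eq_iff.1 hj with ⟨rfl, rfl⟩ | ⟨rfl, rfl⟩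
    · exact hpq
    · exact hpq.symm

/-- If a special ear decomposition of `B` uses the matching edges of `μ`, then graphs with the unique
perfect matching `μ` contain no cycle in `B`. -/
lemma not_isCycle_of_specialEarDecomposition {B M : G.Subgraph} (D : BipartiteEarDecomposition B)
    (hD : ∀ i, IsPerfectMatchingOf (M ⊓ D.graph i) (D.graph i))
    (hD' : ∀ i : Fin D.r, (M ⊓ D.graph i.castSucc).Adj (D.u i) (D.v i))
    (hM : ∀ a b, M.Adj a b → b = μ a) {H : SimpleGraph V} (hH : IsUniquePM H μ) {x : V}
    {C : H.Walk x x} (hC : C.IsCycle) (hsub : ∀ p q, C.toSubgraph.Adj p q → B.Adj p q) :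
    False := by
  have hcl : ∀ i, ∀ v ∈ (D.graph i).verts, (D.graph i).Adj v (μ v) := by
    intro i v hv
    obtain ⟨w, hw, -⟩ := (hD i).2.1 (by rw [(hD i).2.2]; exact hv)
    rw [← hM v w hw.1]
    exact hw.2
  have key : ∀ i : Fin (D.r + 1),
      ¬ ∀ p q, C.toSubgraph.Adj p q → (D.graph i).Adj p q := by
    intro i
    induction i using Fin.induction with
    | zero =>
      intro h
      obtain ⟨a, b, hab, e⟩ := D.graph_zero
      rw [e] at h
      exact not_isCycle_of_subset_subgraphOfAdj hab hC h
    | succ i ih =>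
      intro h
      rw [D.graph_succ] at h
      have hcl' := hcl i.succ
      rw [D.graph_succ] at hcl'
      have hear := D.isEar i
      have hv := hM _ _ (hD' i).1
      -- The type of the ear mentions its end, so the ear is generalized before that end is
      -- rewritten as `μ` of its start.
      revert hear h hcl'
      generalize D.ear i = P
      revert P
      rw [hv]
      intro P h hcl' hear
      obtain ⟨k, hk, hkH⟩ := hH.exists_edge_notMem (hcl i.castSucc) hear hcl'
      exact ih (hear.adj_of_isCycle hC h hk fun hadj => hkH hadj.adj_sub)
  refine key (Fin.last D.r) ?_
  rwa [D.graph_last]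

lemma IsNormalComponent.eq_of_mem {N N' : G.Subgraph} (hN : IsNormalComponent N)
    (hN' : IsNormalComponent N') {v : V} (hv : v ∈ N.verts) (hv' : v ∈ N'.verts) : N = N' := by
  have hp : N ⊔ N' ≤ nonFixedSubgraph G ∧ (N ⊔ N').Connected :=
    ⟨sup_le hN.1.1 hN'.1.1, Subgraph.connected_sup hN.1.2.preconnected hN'.1.2.preconnected
      ⟨v, hv, hv'⟩⟩
  exact le_antisymm (le_sup_left.trans (hN'.2 hp le_sup_right))
    (le_sup_right.trans (hN.2 hp le_sup_left))

/-- The matchings of the special ear decompositions combine to a rigid perfect matching. -/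
theorem exists_rigid [Finite V] (hG : ∃ M : G.Subgraph, M.IsPerfectMatching)
    (hB : ∀ B : G.Subgraph, IsBlock B →
      (∃ (a b : V) (h : G.Adj a b), IsFixedEdge G s(a, b) ∧ B = G.subgraphOfAdj h) ∨
      (IsNormalComponent B ∧ HasSpecialEarDecomposition B)) : ∃ μ, Rigid G μ := by
  classical
  obtain ⟨M₀, hM₀⟩ := hG
  obtain ⟨μ₀, hμ₀, -⟩ := exists_isPM hM₀
  let S : G.Subgraph → Prop := fun B => IsNormalComponent B ∧ HasSpecialEarDecomposition B
  have hS : ∀ B : G.Subgraph, S B → ∃ M : G.Subgraph, IsPerfectMatchingOf M B ∧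
      ∃ D : BipartiteEarDecomposition B,
        (∀ i, IsPerfectMatchingOf (M ⊓ D.graph i) (D.graph i)) ∧
        ∀ i : Fin D.r, (M ⊓ D.graph i.castSucc).Adj (D.u i) (D.v i) := by
    rintro B ⟨-, M, D, h1, -, -, h2, h3⟩
    exact ⟨M, h1, D, h2, h3⟩
  choose! m hm hD using hS
  -- Normal components are disjoint, so their chosen matchings fit together; `μ₀` serves the
  -- remaining vertices and matches them among themselves, since it preserves each normal component.
  have hex : ∀ v, ∃ w, (∀ B, S B → v ∈ B.verts → (m B).Adj v w) ∧
      ((¬ ∃ B, S B ∧ v ∈ B.verts) → w = μ₀ v) := by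
    intro v
    by_cases hv : ∃ B, S B ∧ v ∈ B.verts
    · obtain ⟨B, hSB, hvB⟩ := hv
      obtain ⟨w, hw, -⟩ := (hm B hSB).2.1 (by rw [(hm B hSB).2.2]; exact hvB)
      refine ⟨w, fun B' hB' hv' => ?_, fun h => absurd ⟨B, hSB, hvB⟩ h⟩
      rwa [hB'.1.eq_of_mem hSB.1 hv' hvB]
    · exact ⟨μ₀ v, fun B hSB hvB => absurd ⟨B, hSB, hvB⟩ hv, fun _ => rfl⟩
  choose μ h1 h2 using hex
  have hμ : IsPM G μ := by
    constructor
    · intro v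
      by_cases hv : ∃ B, S B ∧ v ∈ B.verts
      · obtain ⟨B, hSB, hvB⟩ := hv
        exact (h1 v B hSB hvB).adj_sub
      · rw [h2 v hv]
        exact hμ₀.adj v
    · intro v
      by_cases hv : ∃ B, S B ∧ v ∈ B.verts
      · obtain ⟨B, hSB, hvB⟩ := hv
        have hadj := h1 v B hSB hvB
        have hμv : μ v ∈ B.verts := (hm B hSB).1.1 hadj.snd_mem
        exact (hm B hSB).2.1.eq_of_adj_left (h1 _ B hSB hμv) hadj.symm
      · have hv' : ¬ ∃ B, S B ∧ μ₀ v ∈ B.verts := by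
          rintro ⟨B, hSB, hvB⟩
          have := hSB.1.adj_of_mem hvB (nonFixedSubgraph_adj_of_mem hμ₀ (hSB.1.1.1.1 hvB))
          rw [hμ₀.invol] at this
          exact hv ⟨B, hSB, this.snd_mem⟩
        rw [h2 v hv, h2 _ hv', hμ₀.invol]
  refine ⟨μ, hμ, fun H hHG hH x C hC => ?_⟩
  have hC' : (C.mapLe hHG).IsCycle := hC.mapLe hHG
  obtain ⟨B, hBB, hle⟩ := exists_isBlock_ge (isNonseparable_toSubgraph_of_isCycle hC')
  have hsub : ∀ p q, C.toSubgraph.Adj p q → B.Adj p q := fun p q h =>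
    hle.2 ((Walk.adj_toSubgraph_mapLe hHG).2 h)
  rcases hB B hBB with ⟨a, b, hab, -, rfl⟩ | hSB
  · exact not_isCycle_of_subset_subgraphOfAdj hab hC hsub
  · obtain ⟨D, hD1, hD2⟩ := hD B hSB
    refine not_isCycle_of_specialEarDecomposition (μ := μ) D hD1 hD2 (fun a b hab => ?_) hH hC hsub
    exact (hm B hSB).2.1.eq_of_adj_left hab (h1 a B hSB ((hm B hSB).1.1 hab.fst_mem))

end AntiForcing

theorem theorem3p5 {V : Type*} [Finite V] (G : SimpleGraph V)
    (hG : ∃ M : G.Subgraph, M.IsPerfectMatching) :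
    (AntiForcing.maxAntiForcingNumber G : ℤ) = AntiForcing.cyclomaticNumber G ↔
      AntiForcing.IsPlanar G ∧ G.IsBipartite ∧
        ∀ B : G.Subgraph, AntiForcing.IsBlock B →
          (∃ (a b : V) (h : G.Adj a b),
            AntiForcing.IsFixedEdge G s(a, b) ∧ B = G.subgraphOfAdj h) ∨
          (AntiForcing.IsNormalComponent B ∧ AntiForcing.HasSpecialEarDecomposition B) := by
  rw [AntiForcing.maxAntiForcingNumber_eq_iff hG]
  constructor
  · rintro ⟨μ, hr⟩
    exact ⟨hr.drawable.isPlanar, hr.isBipartite, fun B hB =>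
      (hr.isBlock_cases hB).imp_right fun hN => ⟨hN, hr.hasSpecialEarDecomposition hN⟩⟩
  · rintro ⟨-, -, hB⟩
    exact AntiForcing.exists_rigid hG hB
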